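/- Let $\mathit{PAct}$ be a set of prioritized actions containing the silent action $\tau$ (ranged over by $\alpha$), let $\mathit{Act}=\mathit{PAct}\cup\{\delta\}$ with $\delta\notin\mathit{PAct}$ (ranged over by $\gamma$), and let there be a denumerable set of variables $X$. Let $\mathcal E$ be the set of expressions $$E ::= 0 \mid X \mid \gamma.E \mid E+E \mid \mathsf{rec}X.E,$$ let $\mathcal E_{pri}$ be its extension by a unary operator $\mathsf{pri}(E)$, both taken up to renaming of bound variables, and let $\mathcal P$ be the set of closed terms of $\mathcal E$ (processes). Recursion may be unguarded. Transitions $P\xrightarrow{\gamma}P'$ between closed terms are generated by: $\gamma.P\xrightarrow{\gamma}P$; if $P\xrightarrow{\alpha}P'$ then $P+Q\xrightarrow{\alpha}P'$ and $Q+P\xrightarrow{\alpha}P'$; if $P\xrightarrow{\delta}P'$ and $Q$ has no $\tau$-transition, then $P+Q\xrightarrow{\delta}P'$ and $Q+P\xrightarrow{\delta}P'$; if $E\{\mathsf{rec}X.E/X\}\xrightarrow{\gamma}P'$ then $\mathsf{rec}X.E\xrightarrow{\gamma}P'$; and (for $\mathsf{pri}$) if $P\xrightarrow{\alpha}P'$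 then $\mathsf{pri}(P)\xrightarrow{\alpha}P'$. (The rules are stratified: first all $\alpha$-transitions, then the $\delta$-transitions.) Write $\stackrel{\gamma}{\Rightarrow}$ for $(\xrightarrow{\tau})^*\xrightarrow{\gamma}(\xrightarrow{\tau})^*$, and let $\stackrel{\hat\gamma}{\Rightarrow}$ be $\stackrel{\gamma}{\Rightarrow}$ if $\gamma\ne\tau$ and $(\xrightarrow{\tau})^*$ if $\gamma=\tau$. A relation $\beta\subseteq\mathcal P\times\mathcal P$ is a weak bisimulation if for all $(P,Q)\in\beta$: whenever $P\xrightarrow{\gamma}P'$ there is $Q'$ with $Q\stackrel{\hat\gamma}{\Rightarrow}Q'$ and $(P',Q')\in\beta$, and whenever $Q\xrightarrow{\gamma}Q'$ there is $P'$ with $P\stackrel{\hat\gamma}{\Rightarrow}P'$ and $(P',Q')\in\beta$. Write $P\approx Q$ if some weak bisimulation contains $(P,Q)$. Processes $P,Q$ are observationally congruent, $P\simeq Q$, if whenever $P\xrightarrow{\gamma}P'$ there is $Q'$ with $Q\stackrel{\gamma}{\Rightarrow}Q'$ and $P'\approx Q'$, and whenever $Q\xrightarrow{\gamma}Q'$ there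 is $P'$ with $P\stackrel{\gamma}{\Rightarrow}P'$ and $P'\approx Q'$. A free occurrence of $X$ in $E$ is strongly guarded if it lies within a subexpression $\gamma.F$ of $E$ with $\gamma\neq\tau$; $X$ is strongly guarded in $E$ if all its free occurrences are. $X$ is serial in $E$ if every subexpression of $E$ containing $X$ free, apart from $X$ itself, has the form $\gamma.F$, $F+F'$ or $\mathsf{rec}Y.F$. Let $\mathcal A$ be the following axiom system, where $E,F,G$ range over $\mathcal E_{pri}$: - (A1) $E+F=F+E$; (A2) $(E+F)+G=E+(F+G)$; (A3) $E+E=E$; (A4) $E+0=E$. - (Tau1) $\gamma.\tau.E=\gamma.E$; (Tau2) $E+\tau.E=\tau.E$; (Tau3) $\gamma.(E+\tau.F)+\gamma.F=\gamma.(E+\tau.F)$. - (Pri1) $\mathsf{pri}(0)=0$; (Pri2) $\mathsf{pri}(\alpha.E)=\alpha.E$; (Pri3) $\mathsf{pri}(\delta.E)=0$; (Pri4) $\mathsf{pri}(E+F)=\mathsf{pri}(E)+\mathsf{pri}(F)$; (Pri5) $\mathsf{pri}(\mathsf{pri}(E))=\mathsf{pri}(E)$; (Pri6) $\tau.E+F=\tau.E+\mathsf{pri}(F)$.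 - (Rec1) $\mathsf{rec}X.E=E\{\mathsf{rec}X.E/X\}$; (Rec2) if $F=E\{F/X\}$ then $F=\mathsf{rec}X.E$, provided $X$ is serial and strongly guarded in $E$. - (Ung1) $\mathsf{rec}X.(X+E)=\mathsf{rec}X.E$; (Ung2) $\mathsf{rec}X.(\tau.X+E)=\mathsf{rec}X.(\tau.\mathsf{pri}(E))$; (Ung3) $\mathsf{rec}X.(\tau.(X+E)+F)=\mathsf{rec}X.(\tau.X+E+F)$; (Ung4) $\mathsf{rec}X.(\tau.(\mathsf{pri}(X)+E)+F)=\mathsf{rec}X.(\tau.X+E+F)$. Write $\mathcal A\vdash E=F$ if $E=F$ is derivable from $\mathcal A$ by equational reasoning over $\mathcal E_{pri}$ (reflexivity, symmetry, transitivity, and congruence with respect to prefix, choice, recursion and $\mathsf{pri}$). **Theorem (completeness).** Let $P,Q\in\mathcal P$. If $P\simeq Q$ then $\mathcal A\vdash P=Q$. -/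

import Mathlib

/-!
# The basic calculus with prioritized `τ`, observational congruence, and the axiom system

Expressions are taken up to renaming of bound variables. This is realised by de Bruijn indices:
the variables are the natural numbers, `mu` binds index `0` of its body, and under a binder the
free variable `k` is written `k + 1`.
-/

namespace PriorityCalculus

universe u v

/-- Prioritized actions: the silent action `τ` and the visible actions `a : A`. -/
inductive PAct (A : Type u) : Type u
  | tau : PAct A
  | vis (a : A) : PAct A

/-- All actions: the prioritized ones and the unprioritized action `δ`. -/
inductive Act (A : Type u) : Type u
  | prio (α : PAct A) : Act A
  | delta : Act A

/-- The silent action, as an element of the set of all actions. -/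
abbrev Act.tau {A : Type u} : Act A := Act.prio PAct.tau

/-- Behaviour expressions, including the auxiliary operator `pri`:
`E ::= 0 | X | γ.E | E + E | rec X.E | pri(E)`. -/
inductive Expr (A : Type u) : Type u
  | nil : Expr A
  | var (k : ℕ) : Expr A
  | pre (γ : Act A) (E : Expr A) : Expr A
  | sum (E F : Expr A) : Expr A
  | mu (E : Expr A) : Expr A
  | pri (E : Expr A) : Expr A

namespace Expr

variable {A : Type u}

/-- The prefix `τ.E`. -/
abbrev tau (E : Expr A) : Expr A := pre Act.tau E

/-- The variable with index `k` occurs free in the expression. -/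
def FreeIn : ℕ → Expr A → Prop
  | _, nil => False
  | k, var j => j = k
  | k, pre _ E => FreeIn k E
  | k, sum E F => FreeIn k E ∨ FreeIn k F
  | k, mu E => FreeIn (k + 1) E
  | k, pri E => FreeIn k E

/-- The expression has no free variables. -/
def Closed (E : Expr A) : Prop := ∀ k, ¬ FreeIn k E

/-- The expression belongs to the basic calculus: it does not contain the operator `pri`. -/
def PriFree : Expr A → Prop
  | nil => True
  | var _ => True
  | pre _ E => PriFree E
  | sum E F => PriFree E ∧ PriFree F
  | mu E => PriFree E
  | pri _ => False

/-- A renaming of the variables, pushed under one binder. -/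
def liftRen (ρ : ℕ → ℕ) : ℕ → ℕ
  | 0 => 0
  | k + 1 => ρ k + 1

/-- Renaming of free variables. -/
def rename : (ℕ → ℕ) → Expr A → Expr A
  | _, nil => nil
  | ρ, var k => var (ρ k)
  | ρ, pre γ E => pre γ (rename ρ E)
  | ρ, sum E F => sum (rename ρ E) (rename ρ F)
  | ρ, mu E => mu (rename (liftRen ρ) E)
  | ρ, pri E => pri (rename ρ E)

/-- A substitution, pushed under one binder. -/
def liftSubst (σ : ℕ → Expr A) : ℕ → Expr A
  | 0 => var 0
  | k + 1 => rename Nat.succ (σ k)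

/-- Capture-avoiding simultaneous substitution. -/
def subst : (ℕ → Expr A) → Expr A → Expr A
  | _, nil => nil
  | σ, var k => σ k
  | σ, pre γ E => pre γ (subst σ E)
  | σ, sum E F => sum (subst σ E) (subst σ F)
  | σ, mu E => mu (subst (liftSubst σ) E)
  | σ, pri E => pri (subst σ E)

/-- The substitution that replaces the variable `0` by `F` and removes its binder. -/
def instSubst (F : Expr A) : ℕ → Expr A
  | 0 => F
  | k + 1 => var k

/-- `E.inst F` is `E{F/X}`, where `X` is the variable that `rec X.E`, that is `mu E`, binds. -/
def inst (E F : Expr A) : Expr A := subst (instSubst F) E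

/-- The variable `k` is strongly guarded: every free occurrence of it lies within a subexpression
`γ.F` with `γ ≠ τ`. -/
def Guarded : ℕ → Expr A → Prop
  | _, nil => True
  | k, var j => j ≠ k
  | k, pre γ E => γ ≠ Act.tau ∨ Guarded k E
  | k, sum E F => Guarded k E ∧ Guarded k F
  | k, mu E => Guarded (k + 1) E
  | k, pri E => Guarded k E

/-- The variable `k` is serial: every subexpression that contains it free, apart from the variable
itself, is a prefix, a choice or a recursion; in other words, it is never free inside a `pri`. -/
def Serial : ℕ → Expr A → Prop
  | _, nil => True
  | _, var _ => True
  | k, pre _ E => Serial k E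
  | k, sum E F => Serial k E ∧ Serial k F
  | k, mu E => Serial (k + 1) E
  | k, pri E => ¬ FreeIn k E

/-- The transitions labelled by prioritized actions. -/
inductive PStep : Expr A → PAct A → Expr A → Prop
  | pre (α : PAct A) (P : Expr A) : PStep (pre (Act.prio α) P) α P
  | sumL {P P' : Expr A} {α : PAct A} (Q : Expr A) : PStep P α P' → PStep (sum P Q) α P'
  | sumR {Q Q' : Expr A} {α : PAct A} (P : Expr A) : PStep Q α Q' → PStep (sum P Q) α Q'
  | mu {E P' : Expr A} {α : PAct A} : PStep (inst E (mu E)) α P' → PStep (mu E) α P'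
  | pri {P P' : Expr A} {α : PAct A} : PStep P α P' → PStep (pri P) α P'

/-- The transitions labelled by `δ`. The negative premises only concern `τ`-transitions, which
belong to the lower stratum `PStep`. -/
inductive DStep : Expr A → Expr A → Prop
  | pre (P : Expr A) : DStep (pre Act.delta P) P
  | sumL {P P' Q : Expr A} : DStep P P' → (¬ ∃ Q', PStep Q PAct.tau Q') → DStep (sum P Q) P'
  | sumR {P Q Q' : Expr A} : DStep Q Q' → (¬ ∃ P', PStep P PAct.tau P') → DStep (sum P Q) Q'
  | mu {E P' : Expr A} : DStep (inst E (mu E)) P' → DStep (mu E) P'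

/-- The transition relation `P --γ--> P'`. -/
def Step (P : Expr A) : Act A → Expr A → Prop
  | Act.prio α, P' => PStep P α P'
  | Act.delta, P' => DStep P P'

end Expr

/-- Processes: the closed expressions of the basic calculus (without `pri`). -/
def Proc (A : Type u) : Type u := {E : Expr A // E.PriFree ∧ E.Closed}

/-- The transition relation between processes. -/
def Proc.Step {A : Type u} (P : Proc A) (γ : Act A) (P' : Proc A) : Prop :=
  Expr.Step P.1 γ P'.1

section Bisimulation

variable {A : Type u} {S : Type v} (tr : S → Act A → S → Prop)

/-- Sequences of `τ`-transitions, possibly empty. -/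
def TauStar : S → S → Prop := Relation.ReflTransGen (fun p q => tr p Act.tau q)

/-- Weak transitions `==γ==> = --τ-->* --γ--> --τ-->*`; for `γ = τ` at least one `τ` is done. -/
def Weak (p : S) (γ : Act A) (q : S) : Prop :=
  ∃ p' q', TauStar tr p p' ∧ tr p' γ q' ∧ TauStar tr q' q

/-- The weak transitions of weak bisimulation: `--τ-->*` if `γ = τ`, and `==γ==>` otherwise. -/
def WeakHat (p : S) (γ : Act A) (q : S) : Prop :=
  (γ = Act.tau ∧ TauStar tr p q) ∨ (γ ≠ Act.tau ∧ Weak tr p γ q)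

/-- Weak bisimulations. -/
def IsWeakBisimulation (β : S → S → Prop) : Prop :=
  ∀ p q, β p q →
    (∀ γ p', tr p γ p' → ∃ q', WeakHat tr q γ q' ∧ β p' q') ∧
    (∀ γ q', tr q γ q' → ∃ p', WeakHat tr p γ p' ∧ β p' q')

/-- Weak bisimilarity `≈`. -/
def WeakBisimilar (p q : S) : Prop := ∃ β, IsWeakBisimulation tr β ∧ β p q

/-- Observational congruence `≃`. -/
def ObsCongruent (p q : S) : Prop :=
  (∀ γ p', tr p γ p' → ∃ q', Weak tr q γ q' ∧ WeakBisimilar tr p' q') ∧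
  (∀ γ q', tr q γ q' → ∃ p', Weak tr p γ p' ∧ WeakBisimilar tr p' q')

end Bisimulation

open PriorityCalculus.Expr in
/-- `Provable E F` says that the equation `E = F` between (possibly open) expressions, possibly
with `pri`, is derivable from the axiom system by equational reasoning: equivalence,
congruence with respect to all operators, and the axioms below. In `mu E` the bound variable is
`var 0` and may occur in the body. -/
inductive Provable {A : Type u} : Expr A → Expr A → Prop
  | refl (E : Expr A) : Provable E E
  | symm {E F : Expr A} : Provable E F → Provable F E
  | trans {E F G : Expr A} : Provable E F → Provable F G → Provable E G
  | congrPre (γ : Act A) {E F : Expr A} : Provable E F → Provable (pre γ E) (pre γ F)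
  | congrSum {E E' F F' : Expr A} :
      Provable E E' → Provable F F' → Provable (sum E F) (sum E' F')
  | congrMu {E F : Expr A} : Provable E F → Provable (mu E) (mu F)
  | congrPri {E F : Expr A} : Provable E F → Provable (pri E) (pri F)
  | A1 (E F : Expr A) : Provable (sum E F) (sum F E)
  | A2 (E F G : Expr A) : Provable (sum (sum E F) G) (sum E (sum F G))
  | A3 (E : Expr A) : Provable (sum E E) E
  | A4 (E : Expr A) : Provable (sum E nil) E
  | Tau1 (γ : Act A) (E : Expr A) : Provable (pre γ (tau E)) (pre γ E)
  | Tau2 (E : Expr A) : Provable (sum E (tau E)) (tau E)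
  | Tau3 (γ : Act A) (E F : Expr A) :
      Provable (sum (pre γ (sum E (tau F))) (pre γ F)) (pre γ (sum E (tau F)))
  | Pri1 : Provable (pri nil) nil
  | Pri2 (α : PAct A) (E : Expr A) :
      Provable (pri (pre (Act.prio α) E)) (pre (Act.prio α) E)
  | Pri3 (E : Expr A) : Provable (pri (pre Act.delta E)) nil
  | Pri4 (E F : Expr A) : Provable (pri (sum E F)) (sum (pri E) (pri F))
  | Pri5 (E : Expr A) : Provable (pri (pri E)) (pri E)
  | Pri6 (E F : Expr A) : Provable (sum (tau E) F) (sum (tau E) (pri F))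
  | Rec1 (E : Expr A) : Provable (mu E) (inst E (mu E))
  | Rec2 (E F : Expr A) :
      Serial 0 E → Guarded 0 E → Provable F (inst E F) → Provable F (mu E)
  | Ung1 (E : Expr A) : Provable (mu (sum (var 0) E)) (mu E)
  | Ung2 (E : Expr A) : Provable (mu (sum (tau (var 0)) E)) (mu (tau (pri E)))
  | Ung3 (E F : Expr A) :
      Provable (mu (sum (tau (sum (var 0) E)) F)) (mu (sum (sum (tau (var 0)) E) F))
  | Ung4 (E F : Expr A) :
      Provable (mu (sum (tau (sum (pri (var 0)) E)) F)) (mu (sum (sum (tau (var 0)) E) F))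

end PriorityCalculus

namespace PriorityCalculus

universe u v

namespace Expr

variable {A : Type u}

/-! ### Substitution -/

/-! The proof passes to expressions in which all recursion is strongly guarded. Normalisation must
be both derivable and sound, since the congruence of the two processes has to be carried over to
their normal forms; hence `Eqv` bundles derivability with observational congruence, and soundness is
shown only for the axioms used there. That recursion respects congruence rests on
`cong_mu_of_solves`.

`Flat.exists_guarded_mu` removes unguarded occurrences of a bound variable X. A bare summand X
disappears by Ung1. If a summand τ.U exposes X, then U has X or pri(X) as a summand by Tau2, so Ung3
or Ung4 replaces τ.U by τ.X + U. Beside the loop τ.X the remaining unguarded occurrences are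
absorbed or dissolved, and Ung2 trades the loop for τ.pri(...): divergence is forgotten, but its
pre-emption of δ stays.

A normal form has finitely many derivatives (`exists_finite_closed`) and no τ-cycles
(`PStep.unguardedSize_lt`), is provably the sum of its transitions (`exists_choice`), and absorbs
its weak transitions (`Regular.summand_of_weak`). Bisimilar pairs from a finite set closed under
transitions index an equation system whose summands are the common weak moves. Up to a leading τ
both projections solve it, and solutions are unique by iterated Rec2 (`provable_of_solves`), so γ.P
= γ.Q is derivable for bisimilar P and Q (`provable_pre_of_bisim`). If P and Q are congruent, each
summand γ.P' of P therefore equals some γ.Q' that is a summand of Q, and conversely. -/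

theorem liftRen_comp (ρ ρ' : ℕ → ℕ) : liftRen ρ ∘ liftRen ρ' = liftRen (ρ ∘ ρ') := by
  funext k; cases k <;> rfl

theorem rename_rename (ρ ρ' : ℕ → ℕ) (E : Expr A) :
    rename ρ (rename ρ' E) = rename (ρ ∘ ρ') E := by
  induction E generalizing ρ ρ' with
  | mu E ih => simp only [rename, ih, liftRen_comp]
  | _ => simp_all [rename]

theorem liftSubst_comp_liftRen (σ : ℕ → Expr A) (ρ : ℕ → ℕ) :
    liftSubst σ ∘ liftRen ρ = liftSubst (σ ∘ ρ) := by
  funext k; cases k <;> rfl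

theorem subst_rename (σ : ℕ → Expr A) (ρ : ℕ → ℕ) (E : Expr A) :
    subst σ (rename ρ E) = subst (σ ∘ ρ) E := by
  induction E generalizing σ ρ with
  | mu E ih => simp only [rename, subst, ih, liftSubst_comp_liftRen]
  | _ => simp_all [rename, subst]

theorem rename_liftSubst (ρ : ℕ → ℕ) (σ : ℕ → Expr A) :
    (fun k => rename (liftRen ρ) (liftSubst σ k)) = liftSubst (fun k => rename ρ (σ k)) := by
  funext k
  cases k with
  | zero => rfl
  | succ k => simp only [liftSubst, rename_rename]; rfl

theorem rename_subst (ρ : ℕ → ℕ) (σ : ℕ → Expr A) (E : Expr A) :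
    rename ρ (subst σ E) = subst (fun k => rename ρ (σ k)) E := by
  induction E generalizing σ ρ with
  | mu E ih => simp only [rename, subst, ih, rename_liftSubst]
  | _ => simp_all [rename, subst]

theorem subst_liftSubst (σ σ' : ℕ → Expr A) :
    (fun k => subst (liftSubst σ) (liftSubst σ' k)) = liftSubst (fun k => subst σ (σ' k)) := by
  funext k
  cases k with
  | zero => rfl
  | succ k => simp only [liftSubst, subst_rename, rename_subst]; rfl

theorem subst_subst (σ σ' : ℕ → Expr A) (E : Expr A) :
    subst σ (subst σ' E) = subst (fun k => subst σ (σ' k)) E := by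
  induction E generalizing σ σ' with
  | mu E ih => simp only [subst, ih, subst_liftSubst]
  | _ => simp_all [subst]

theorem liftSubst_var : liftSubst (var : ℕ → Expr A) = var := by
  funext k; cases k <;> rfl

theorem subst_var (E : Expr A) : subst var E = E := by
  induction E with
  | mu E ih => simp only [subst, liftSubst_var, ih]
  | _ => simp_all [subst]

theorem inst_rename_succ (E F : Expr A) : inst (rename Nat.succ E) F = E := by
  rw [inst, subst_rename]; exact subst_var E

/-- The substitution `σ` extended by `F` at index `0`. -/
def consSubst (F : Expr A) (σ : ℕ → Expr A) : ℕ → Expr A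
  | 0 => F
  | k + 1 => σ k

theorem inst_subst_liftSubst (σ : ℕ → Expr A) (E F : Expr A) :
    inst (subst (liftSubst σ) E) F = subst (consSubst F σ) E := by
  rw [inst, subst_subst]
  congr 1
  funext k
  cases k with
  | zero => rfl
  | succ k => exact inst_rename_succ _ _

theorem subst_inst_eq_subst_consSubst (σ : ℕ → Expr A) (E F : Expr A) :
    subst σ (inst E F) = subst (consSubst (subst σ F) σ) E := by
  rw [inst, subst_subst]
  congr 1
  funext k
  cases k <;> rfl

theorem subst_inst (σ : ℕ → Expr A) (E F : Expr A) :
    subst σ (inst E F) = inst (subst (liftSubst σ) E) (subst σ F) := by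
  rw [inst_subst_liftSubst, subst_inst_eq_subst_consSubst]

theorem subst_unfold (σ : ℕ → Expr A) (E : Expr A) :
    subst σ (inst E (mu E)) =
      inst (subst (liftSubst σ) E) (mu (subst (liftSubst σ) E)) :=
  subst_inst σ E (mu E)

/-! ### Free variables and closed expressions -/

theorem subst_congr_of_freeIn {σ σ' : ℕ → Expr A} {E : Expr A}
    (h : ∀ k, FreeIn k E → σ k = σ' k) : subst σ E = subst σ' E := by
  induction E generalizing σ σ' with
  | nil => rfl
  | var k => exact h k rfl
  | pre γ E ih => simp only [subst]; rw [ih h]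
  | sum E F ihE ihF =>
    simp only [subst]
    rw [ihE fun k hk => h k (Or.inl hk), ihF fun k hk => h k (Or.inr hk)]
  | mu E ih =>
    simp only [subst]
    rw [ih]
    intro k hk
    cases k with
    | zero => rfl
    | succ k => simp only [liftSubst]; rw [h k hk]
  | pri E ih => simp only [subst]; rw [ih h]

theorem eq_var_of_rename_eq_var {ρ : ℕ → ℕ} {E : Expr A} {k : ℕ} (h : rename ρ E = var k) :
    ∃ j, E = var j ∧ ρ j = k := by
  cases E <;> simp_all [rename]

theorem apply_eq_var_of_subst_eq_self {σ : ℕ → Expr A} {E : Expr A} {k : ℕ}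
    (h : subst σ E = E) (hk : FreeIn k E) : σ k = var k := by
  induction E generalizing σ k with
  | nil => exact hk.elim
  | var j => cases hk; exact h
  | pre γ E ih => simp only [subst, pre.injEq, true_and] at h; exact ih h hk
  | sum E F ihE ihF =>
    simp only [subst, sum.injEq] at h
    exact hk.elim (ihE h.1) (ihF h.2)
  | mu E ih =>
    simp only [subst, mu.injEq] at h
    obtain ⟨j, hj, hjk⟩ := eq_var_of_rename_eq_var (ih (k := k + 1) h hk)
    rw [hj, Nat.succ_injective hjk]
  | pri E ih => simp only [subst, pri.injEq] at h; exact ih h hk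

/-- The expression is unchanged by all substitutions. -/
def Fixed (E : Expr A) : Prop := ∀ σ, subst σ E = E

/-- A substitution that leaves an expression unchanged fixes its free variables, so replacing every
variable by `nil` detects them. Invariance is the form of closedness that can be used by rewriting.
-/
theorem closed_iff_fixed {E : Expr A} : Closed E ↔ Fixed E := by
  constructor
  · intro h σ
    conv_rhs => rw [← subst_var E]
    exact subst_congr_of_freeIn fun k hk => (h k hk).elim
  · intro h k hk
    have := apply_eq_var_of_subst_eq_self (h fun _ => nil) hk
    simp at this

theorem Fixed.of_pre {γ : Act A} {E : Expr A} (h : Fixed (pre γ E)) : Fixed E := fun σ => by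
  simpa [subst] using h σ

theorem Fixed.of_sum {E F : Expr A} (h : Fixed (sum E F)) : Fixed E ∧ Fixed F := by
  simpa [Fixed, subst, forall_and] using h

theorem Fixed.of_pri {E : Expr A} (h : Fixed (pri E)) : Fixed E := fun σ => by
  simpa [subst] using h σ

theorem Fixed.unfold {E : Expr A} (h : Fixed (mu E)) : Fixed (inst E (mu E)) := fun σ => by
  have h' := h σ
  simp only [subst, mu.injEq] at h'
  rw [subst_unfold, h']

theorem fixed_subst_nil (E : Expr A) : Fixed (subst (fun _ => nil) E) := fun σ => by
  rw [subst_subst]; rfl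

theorem PriFree.rename {E : Expr A} (h : PriFree E) (ρ : ℕ → ℕ) : PriFree (rename ρ E) := by
  induction E generalizing ρ with
  | sum E F ihE ihF => exact ⟨ihE h.1 ρ, ihF h.2 ρ⟩
  | nil => trivial
  | var => trivial
  | pre γ E ih => exact ih h ρ
  | mu E ih => exact ih h _
  | pri => exact h.elim

theorem PriFree.subst {E : Expr A} (h : PriFree E) {σ : ℕ → Expr A} (hσ : ∀ k, PriFree (σ k)) :
    PriFree (subst σ E) := by
  induction E generalizing σ with
  | sum E F ihE ihF => exact ⟨ihE h.1 hσ, ihF h.2 hσ⟩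
  | nil => trivial
  | var => exact hσ _
  | pre γ E ih => exact ih h hσ
  | mu E ih =>
    refine ih h fun k => ?_
    cases k with
    | zero => trivial
    | succ k => exact (hσ k).rename _
  | pri => exact h.elim

theorem PriFree.inst {E F : Expr A} (hE : PriFree E) (hF : PriFree F) : PriFree (inst E F) :=
  hE.subst fun k => by
    cases k with
    | zero => exact hF
    | succ k => trivial

end Expr

/-! ### Weak bisimilarity and observational congruence in a transition system -/

section LTS

variable {A : Type u} {S : Type v} {tr : S → Act A → S → Prop}

theorem TauStar.trans {p q r : S} (h : TauStar tr p q) (h' : TauStar tr q r) : TauStar tr p r :=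
  Relation.ReflTransGen.trans h h'

theorem TauStar.single {p q : S} (h : tr p Act.tau q) : TauStar tr p q :=
  Relation.ReflTransGen.single h

theorem Weak.single {p q : S} {γ : Act A} (h : tr p γ q) : Weak tr p γ q :=
  ⟨p, q, .refl, h, .refl⟩

theorem Weak.tauStar {p q : S} (h : Weak tr p Act.tau q) : TauStar tr p q := by
  obtain ⟨p', q', h1, h2, h3⟩ := h
  exact (h1.trans (.single h2)).trans h3

theorem Weak.weakHat {p q : S} {γ : Act A} (h : Weak tr p γ q) : WeakHat tr p γ q := by
  by_cases hγ : γ = Act.tau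
  · subst hγ; exact Or.inl ⟨rfl, h.tauStar⟩
  · exact Or.inr ⟨hγ, h⟩

theorem Weak.prepend {p q r : S} {γ : Act A} (h : TauStar tr p q) (h' : Weak tr q γ r) :
    Weak tr p γ r := by
  obtain ⟨p', q', h1, h2, h3⟩ := h'
  exact ⟨p', q', h.trans h1, h2, h3⟩

theorem Weak.append {p q r : S} {γ : Act A} (h : Weak tr p γ q) (h' : TauStar tr q r) :
    Weak tr p γ r := by
  obtain ⟨p', q', h1, h2, h3⟩ := h
  exact ⟨p', q', h1, h2, h3.trans h'⟩

theorem WeakHat.refl (p : S) : WeakHat tr p Act.tau p := Or.inl ⟨rfl, .refl⟩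

theorem WeakHat.prepend {p q r : S} {γ : Act A} (h : TauStar tr p q) (h' : WeakHat tr q γ r) :
    WeakHat tr p γ r :=
  h'.imp (fun ⟨e, h'⟩ => ⟨e, h.trans h'⟩) fun ⟨e, h'⟩ => ⟨e, h'.prepend h⟩

theorem WeakHat.append {p q r : S} {γ : Act A} (h : WeakHat tr p γ q) (h' : TauStar tr q r) :
    WeakHat tr p γ r :=
  h.imp (fun ⟨e, h⟩ => ⟨e, h.trans h'⟩) fun ⟨e, h⟩ => ⟨e, h.append h'⟩

theorem WeakHat.tauStar {p q : S} (h : WeakHat tr p Act.tau q) : TauStar tr p q :=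
  h.elim (·.2) fun h => (h.1 rfl).elim

/-- Every transition on the left is matched by a weak transition on the right. -/
def IsSimulation (tr : S → Act A → S → Prop) (β : S → S → Prop) : Prop :=
  ∀ p q, β p q → ∀ γ p', tr p γ p' → ∃ q', WeakHat tr q γ q' ∧ β p' q'

theorem isWeakBisimulation_iff {β : S → S → Prop} :
    IsWeakBisimulation tr β ↔ IsSimulation tr β ∧ IsSimulation tr (flip β) :=
  ⟨fun h => ⟨fun p q hpq => (h p q hpq).1, fun p q hpq => (h q p hpq).2⟩,
    fun h p q hpq => ⟨h.1 p q hpq, h.2 q p hpq⟩⟩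

theorem IsSimulation.tauStar {β : S → S → Prop} (h : IsSimulation tr β) {p q p' : S}
    (hpq : β p q) (hp : TauStar tr p p') : ∃ q', TauStar tr q q' ∧ β p' q' := by
  induction hp with
  | refl => exact ⟨q, .refl, hpq⟩
  | tail _ hs ih =>
    obtain ⟨q1, hq1, hβ⟩ := ih
    obtain ⟨q2, hq2, hβ2⟩ := h _ _ hβ _ _ hs
    exact ⟨q2, hq1.trans hq2.tauStar, hβ2⟩

theorem IsSimulation.weakHat {β : S → S → Prop} (h : IsSimulation tr β) {p q p' : S}
    {γ : Act A} (hpq : β p q) (hp : WeakHat tr p γ p') : ∃ q', WeakHat tr q γ q' ∧ β p' q' := by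
  obtain ⟨rfl, hp⟩ | ⟨hγ, p1, p2, h1, h2, h3⟩ := hp
  · obtain ⟨q', hq, h⟩ := h.tauStar hpq hp
    exact ⟨q', Or.inl ⟨rfl, hq⟩, h⟩
  · obtain ⟨q1, hq1, hβ1⟩ := h.tauStar hpq h1
    obtain ⟨q2, hq2, hβ2⟩ := h _ _ hβ1 _ _ h2
    obtain ⟨q3, hq3, hβ3⟩ := h.tauStar hβ2 h3
    exact ⟨q3, (hq2.prepend hq1).append hq3, hβ3⟩

theorem isSimulation_weakBisimilar : IsSimulation tr (WeakBisimilar tr) := by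
  rintro p q ⟨β, hβ, hpq⟩ γ p' hp
  obtain ⟨q', h1, h2⟩ := (hβ p q hpq).1 γ p' hp
  exact ⟨q', h1, β, hβ, h2⟩

theorem WeakBisimilar.refl (p : S) : WeakBisimilar tr p p := by
  refine ⟨Eq, fun p q h => ?_, rfl⟩
  subst h
  exact ⟨fun γ p' h => ⟨p', (Weak.single h).weakHat, rfl⟩,
    fun γ p' h => ⟨p', (Weak.single h).weakHat, rfl⟩⟩

theorem WeakBisimilar.symm {p q : S} (h : WeakBisimilar tr p q) : WeakBisimilar tr q p := by
  obtain ⟨β, hβ, hpq⟩ := h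
  exact ⟨flip β, fun p q h => ⟨(hβ q p h).2, (hβ q p h).1⟩, hpq⟩

theorem WeakBisimilar.trans {p q r : S} (h : WeakBisimilar tr p q) (h' : WeakBisimilar tr q r) :
    WeakBisimilar tr p r := by
  refine ⟨fun p r => ∃ q, WeakBisimilar tr p q ∧ WeakBisimilar tr q r, ?_, q, h, h'⟩
  have key : IsSimulation tr fun p r => ∃ q, WeakBisimilar tr p q ∧ WeakBisimilar tr q r := by
    rintro p r ⟨q, h, h'⟩ γ p' hp
    obtain ⟨q', hq, hb⟩ := isSimulation_weakBisimilar _ _ h _ _ hp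
    obtain ⟨r', hr, hb'⟩ := isSimulation_weakBisimilar.weakHat h' hq
    exact ⟨r', hr, q', hb, hb'⟩
  refine isWeakBisimulation_iff.2 ⟨key, fun r p ⟨q, h, h'⟩ γ p' hp => ?_⟩
  obtain ⟨q', hq, r, h1, h2⟩ := key _ _ ⟨q, h'.symm, h.symm⟩ γ p' hp
  exact ⟨q', hq, r, h2.symm, h1.symm⟩

/-- Simulation up to weak bisimilarity of the targets on the right. -/
def IsSimulationUpTo (tr : S → Act A → S → Prop) (β : S → S → Prop) : Prop :=
  ∀ p q, β p q → ∀ γ p', tr p γ p' →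
    ∃ q' r, WeakHat tr q γ q' ∧ β p' r ∧ WeakBisimilar tr r q'

/-- The state reached by `q` is only bisimilar to the `β`-partner of the current left state: the
partner answers the next step, and the answer is carried over. This works because no bisimilarity is
allowed on the side that moves. -/
theorem IsSimulationUpTo.tauStar {β : S → S → Prop} (h : IsSimulationUpTo tr β) {p q p' : S}
    (hpq : β p q) (hp : TauStar tr p p') :
    ∃ q' r, TauStar tr q q' ∧ β p' r ∧ WeakBisimilar tr r q' := by
  induction hp with
  | refl => exact ⟨q, q, .refl, hpq, .refl q⟩
  | tail _ hs ih =>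
    obtain ⟨q1, r1, hq1, hβ, hr1⟩ := ih
    obtain ⟨r2, s, hr2, hβ2, hs2⟩ := h _ _ hβ _ _ hs
    obtain ⟨q2, hq2, hb⟩ := isSimulation_weakBisimilar.tauStar hr1 hr2.tauStar
    exact ⟨q2, s, hq1.trans hq2, hβ2, hs2.trans hb⟩

theorem IsSimulationUpTo.weakHat {β : S → S → Prop} (h : IsSimulationUpTo tr β) {p q p' : S}
    {γ : Act A} (hpq : β p q) (hp : WeakHat tr p γ p') :
    ∃ q' r, WeakHat tr q γ q' ∧ β p' r ∧ WeakBisimilar tr r q' := by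
  obtain ⟨rfl, hp⟩ | ⟨hγ, p1, p2, h1, h2, h3⟩ := hp
  · obtain ⟨q', r, hq, h⟩ := h.tauStar hpq hp
    exact ⟨q', r, Or.inl ⟨rfl, hq⟩, h⟩
  · obtain ⟨q1, r1, hq1, hβ1, hr1⟩ := h.tauStar hpq h1
    obtain ⟨s2, r2, hs2, hβ2, hr2⟩ := h _ _ hβ1 _ _ h2
    obtain ⟨s3, r3, hs3, hβ3, hr3⟩ := h.tauStar hβ2 h3
    obtain ⟨s4, hs4, hr4⟩ := isSimulation_weakBisimilar.tauStar hr2 hs3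
    obtain ⟨q4, hq4, hr5⟩ := isSimulation_weakBisimilar.weakHat hr1 (hs2.append hs4)
    exact ⟨q4, r3, hq4.prepend hq1, hβ3, hr3.trans (hr4.trans hr5)⟩

theorem IsSimulationUpTo.isSimulation {β : S → S → Prop} (h : IsSimulationUpTo tr β) :
    IsSimulation tr fun x y => ∃ p q, WeakBisimilar tr x p ∧ β p q ∧ WeakBisimilar tr q y := by
  rintro x y ⟨p, q, hx, hpq, hy⟩ γ x' hx'
  obtain ⟨p', hp', hb⟩ := isSimulation_weakBisimilar _ _ hx _ _ hx'
  obtain ⟨q', r, hq', hβ, hr⟩ := h.weakHat hpq hp'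
  obtain ⟨y', hy', hb'⟩ := isSimulation_weakBisimilar.weakHat hy hq'
  exact ⟨y', hy', p', r, hb, hβ, hr.trans hb'⟩

theorem WeakBisimilar.of_upTo {β : S → S → Prop} (h : IsSimulationUpTo tr β)
    (h' : IsSimulationUpTo tr (flip β)) {p q : S} (hpq : β p q) : WeakBisimilar tr p q := by
  refine ⟨_, isWeakBisimulation_iff.2 ⟨h.isSimulation, ?_⟩, p, q, .refl p, hpq, .refl q⟩
  rintro y x ⟨p, q, hx, hpq, hy⟩ γ y' hy'
  obtain ⟨x', h1, q', p', h2, h3, h4⟩ := h'.isSimulation y x ⟨q, p, hy.symm, hpq, hx.symm⟩ γ y' hy'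
  exact ⟨x', h1, p', q', h4.symm, h3, h2.symm⟩

/-- Adjoining one pair to `≈` gives a bisimulation. The option of returning to that pair lets a
τ-loop on the left be matched by idling. -/
theorem WeakBisimilar.of_weakHat {p q : S}
    (h : ∀ γ p', tr p γ p' →
      ∃ q', WeakHat tr q γ q' ∧ (p' = p ∧ q' = q ∨ WeakBisimilar tr p' q'))
    (h' : ∀ γ q', tr q γ q' → ∃ p', WeakHat tr p γ p' ∧ WeakBisimilar tr p' q') :
    WeakBisimilar tr p q := by
  refine ⟨fun x y => (x = p ∧ y = q) ∨ WeakBisimilar tr x y, ?_, Or.inl ⟨rfl, rfl⟩⟩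
  rintro x y (⟨rfl, rfl⟩ | hxy)
  · exact ⟨h, fun γ q' hq => (h' γ q' hq).imp fun _ => And.imp_right Or.inr⟩
  · refine ⟨fun γ p' hp => ?_, fun γ q' hq => ?_⟩
    · exact (isSimulation_weakBisimilar _ _ hxy _ _ hp).imp fun _ => And.imp_right Or.inr
    · exact (isSimulation_weakBisimilar _ _ hxy.symm _ _ hq).imp fun _ =>
        And.imp_right fun h => Or.inr h.symm

theorem ObsCongruent.weakBisimilar {p q : S} (h : ObsCongruent tr p q) : WeakBisimilar tr p q :=
  .of_weakHat (fun γ p' hp => (h.1 γ p' hp).imp fun _ => And.imp Weak.weakHat .inr)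
    fun γ p' hp => (h.2 γ p' hp).imp fun _ => And.imp_left Weak.weakHat

theorem ObsCongruent.symm {p q : S} (h : ObsCongruent tr p q) : ObsCongruent tr q p :=
  ⟨fun γ p' hp => (h.2 γ p' hp).imp fun _ => And.imp_right WeakBisimilar.symm,
    fun γ p' hp => (h.1 γ p' hp).imp fun _ => And.imp_right WeakBisimilar.symm⟩

/-- Congruence answers the first step and bisimilarity all later ones. If the first step is a
leading τ, its answer already contains the τ that is required when `γ = τ`. -/
theorem ObsCongruent.weak {p q p' : S} {γ : Act A} (h : ObsCongruent tr p q)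
    (hp : Weak tr p γ p') : ∃ q', Weak tr q γ q' ∧ WeakBisimilar tr p' q' := by
  obtain ⟨p1, p2, h1, h2, h3⟩ := hp
  obtain rfl | ⟨p0, h0, h1⟩ := Relation.ReflTransGen.cases_head h1
  · obtain ⟨q2, hq2, hb2⟩ := h.1 _ _ h2
    obtain ⟨q3, hq3, hb3⟩ := isSimulation_weakBisimilar.tauStar hb2 h3
    exact ⟨q3, hq2.append hq3, hb3⟩
  · obtain ⟨q0, ⟨r1, r2, hr1, hr2, hr3⟩, hb0⟩ := h.1 _ _ h0
    by_cases hγ : γ = Act.tau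
    · subst hγ
      obtain ⟨q', hq', hb⟩ := isSimulation_weakBisimilar.tauStar hb0
        ((h1.trans (.single h2)).trans h3)
      exact ⟨q', ⟨r1, r2, hr1, hr2, hr3.trans hq'⟩, hb⟩
    · obtain ⟨q', hq', hb⟩ := isSimulation_weakBisimilar.weakHat hb0
        (Or.inr ⟨hγ, p1, p2, h1, h2, h3⟩)
      refine ⟨q', ?_, hb⟩
      have hq' := hq'.resolve_left fun h => hγ h.1
      exact hq'.2.prepend ((hr1.trans (.single hr2)).trans hr3)

theorem ObsCongruent.trans {p q r : S} (h : ObsCongruent tr p q) (h' : ObsCongruent tr q r) :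
    ObsCongruent tr p r := by
  constructor
  · intro γ p' hp
    obtain ⟨q', hq, hb⟩ := h.1 _ _ hp
    obtain ⟨r', hr, hb'⟩ := h'.weak hq
    exact ⟨r', hr, hb.trans hb'⟩
  · intro γ r' hr
    obtain ⟨q', hq, hb⟩ := h'.2 _ _ hr
    obtain ⟨p', hp, hb'⟩ := h.symm.weak hq
    exact ⟨p', hp, hb'.symm.trans hb⟩

theorem ObsCongruent.of_tr_iff {p q : S} (h : ∀ γ r, tr p γ r ↔ tr q γ r) :
    ObsCongruent tr p q :=
  ⟨fun γ r hp => ⟨r, .single ((h γ r).1 hp), .refl r⟩,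
    fun γ r hp => ⟨r, .single ((h γ r).2 hp), .refl r⟩⟩

theorem ObsCongruent.refl (p : S) : ObsCongruent tr p p := .of_tr_iff fun _ _ => Iff.rfl

end LTS

namespace Expr

variable {A : Type u}

/-! ### Transitions of expressions -/

/-- Weak bisimilarity of expressions, which are all regarded as states. -/
abbrev Bisim (P Q : Expr A) : Prop := WeakBisimilar Step P Q

/-- Observational congruence of expressions, which are all regarded as states. -/
abbrev Cong (P Q : Expr A) : Prop := ObsCongruent Step P Q

/-- The expression has no `τ`-transition. -/
def Stable (P : Expr A) : Prop := ¬ ∃ P', PStep P PAct.tau P'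

theorem pStep_pre_iff {γ : Act A} {P P' : Expr A} {α : PAct A} :
    PStep (pre γ P) α P' ↔ γ = Act.prio α ∧ P' = P :=
  ⟨fun h => by cases h; exact ⟨rfl, rfl⟩, by rintro ⟨rfl, rfl⟩; exact .pre _ _⟩

theorem pStep_sum_iff {P Q R : Expr A} {α : PAct A} :
    PStep (sum P Q) α R ↔ PStep P α R ∨ PStep Q α R :=
  ⟨fun h => by cases h with
    | sumL _ h => exact .inl h
    | sumR _ h => exact .inr h, fun h => h.elim (.sumL _) (.sumR _)⟩

theorem pStep_mu_iff {E R : Expr A} {α : PAct A} :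
    PStep (mu E) α R ↔ PStep (inst E (mu E)) α R :=
  ⟨fun h => by cases h with | mu h => exact h, .mu⟩

theorem pStep_pri_iff {P R : Expr A} {α : PAct A} : PStep (pri P) α R ↔ PStep P α R :=
  ⟨fun h => by cases h with | pri h => exact h, .pri⟩

theorem dStep_pre_iff {γ : Act A} {P P' : Expr A} :
    DStep (pre γ P) P' ↔ γ = Act.delta ∧ P' = P :=
  ⟨fun h => by cases h; exact ⟨rfl, rfl⟩, by rintro ⟨rfl, rfl⟩; exact .pre _⟩

theorem dStep_mu_iff {E R : Expr A} : DStep (mu E) R ↔ DStep (inst E (mu E)) R :=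
  ⟨fun h => by cases h with | mu h => exact h, .mu⟩

theorem not_dStep_pri {P R : Expr A} : ¬ DStep (pri P) R := nofun

theorem not_pStep_nil {R : Expr A} {α : PAct A} : ¬ PStep nil α R := nofun

theorem not_dStep_nil {R : Expr A} : ¬ DStep nil R := nofun

theorem stable_sum_iff {P Q : Expr A} : Stable (sum P Q) ↔ Stable P ∧ Stable Q := by
  simp only [Stable, pStep_sum_iff, exists_or, not_or]

theorem DStep.stable {P P' : Expr A} (h : DStep P P') : Stable P := by
  induction h with
  | pre P => rintro ⟨Q, h⟩; cases h
  | sumL _ h ih => exact stable_sum_iff.2 ⟨ih, h⟩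
  | sumR _ h ih => exact stable_sum_iff.2 ⟨h, ih⟩
  | mu _ ih => simpa only [Stable, pStep_mu_iff] using ih

theorem dStep_sum_iff {P Q R : Expr A} :
    DStep (sum P Q) R ↔ (DStep P R ∨ DStep Q R) ∧ Stable P ∧ Stable Q := by
  constructor
  · intro h
    refine ⟨?_, stable_sum_iff.1 h.stable⟩
    cases h with
    | sumL h _ => exact .inl h
    | sumR h _ => exact .inr h
  · rintro ⟨h | h, hP, hQ⟩
    · exact .sumL h hQ
    · exact .sumR h hP

theorem not_dStep_tau_sum {P Q R : Expr A} : ¬ DStep (sum (tau P) Q) R := fun h =>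
  (dStep_sum_iff.1 h).2.1 ⟨P, .pre _ _⟩

theorem Weak.exists_dStep {P Q : Expr A} (h : Weak Step P Act.delta Q) (hP : Stable P) :
    ∃ R, DStep P R ∧ TauStar Step R Q := by
  obtain ⟨P1, P2, h1, h2, h3⟩ := h
  obtain rfl | ⟨P0, h0, -⟩ := Relation.ReflTransGen.cases_head h1
  · exact ⟨P2, h2, h3⟩
  · exact (hP ⟨P0, h0⟩).elim

theorem Weak.not_stable {P Q : Expr A} (h : Weak Step P Act.tau Q) : ¬ Stable P := by
  obtain ⟨P1, P2, h1, h2, h3⟩ := h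
  obtain rfl | ⟨P0, h0, -⟩ := Relation.ReflTransGen.cases_head h1
  · exact fun h => h ⟨P2, h2⟩
  · exact fun h => h ⟨P0, h0⟩

theorem Weak.of_pStep_imp {P Q R : Expr A} {α : PAct A}
    (h : ∀ β R, PStep P β R → PStep Q β R) (hP : Weak Step P (Act.prio α) R) :
    Weak Step Q (Act.prio α) R := by
  obtain ⟨P1, P2, h1, h2, h3⟩ := hP
  obtain rfl | ⟨P0, h0, h1⟩ := Relation.ReflTransGen.cases_head h1
  · exact ⟨Q, P2, .refl, h _ _ h2, h3⟩
  · exact ⟨P1, P2, .head (h _ _ h0) h1, h2, h3⟩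

theorem Cong.stable {P Q : Expr A} (h : Cong P Q) (hP : Stable P) : Stable Q := by
  rintro ⟨Q', hQ⟩
  obtain ⟨P', hP', -⟩ := h.2 Act.tau Q' hQ
  exact Weak.not_stable hP' hP

theorem cong_of_iff {P Q : Expr A} (h : ∀ α R, PStep P α R ↔ PStep Q α R)
    (h' : ∀ R, DStep P R ↔ DStep Q R) : Cong P Q := by
  refine .of_tr_iff fun γ R => ?_
  cases γ with
  | prio α => exact h α R
  | delta => exact h' R

theorem cong_unfold (E : Expr A) : Cong (mu E) (inst E (mu E)) :=
  cong_of_iff (fun _ _ => pStep_mu_iff) fun _ => dStep_mu_iff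

theorem Cong.pre (γ : Act A) {P Q : Expr A} (h : Cong P Q) : Cong (pre γ P) (pre γ Q) := by
  have key : ∀ {P Q : Expr A}, Cong P Q → ∀ γ' P', Step (Expr.pre γ P) γ' P' →
      ∃ Q', Weak Step (Expr.pre γ Q) γ' Q' ∧ Bisim P' Q' := by
    intro P Q h γ' P' hP
    cases γ' with
    | prio α =>
      obtain ⟨rfl, rfl⟩ := pStep_pre_iff.1 hP
      exact ⟨Q, .single (PStep.pre α Q), h.weakBisimilar⟩
    | delta =>
      obtain ⟨rfl, rfl⟩ := dStep_pre_iff.1 hP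
      exact ⟨Q, .single (DStep.pre Q), h.weakBisimilar⟩
  refine ⟨key h, fun γ' Q' hQ => ?_⟩
  obtain ⟨P', h1, h2⟩ := key h.symm γ' Q' hQ
  exact ⟨P', h1, h2.symm⟩

theorem Cong.sum {P P' Q Q' : Expr A} (h : Cong P P') (h' : Cong Q Q') :
    Cong (sum P Q) (sum P' Q') := by
  have key : ∀ {P P' Q Q' : Expr A}, Cong P P' → Cong Q Q' → ∀ γ R, Step (Expr.sum P Q) γ R →
      ∃ R', Weak Step (Expr.sum P' Q') γ R' ∧ Bisim R R' := by
    intro P P' Q Q' h h' γ R hR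
    cases γ with
    | prio α =>
      obtain hR | hR := pStep_sum_iff.1 hR
      · obtain ⟨R', h1, h2⟩ := h.1 (Act.prio α) R hR
        exact ⟨R', Weak.of_pStep_imp (fun _ _ => .sumL _) h1, h2⟩
      · obtain ⟨R', h1, h2⟩ := h'.1 (Act.prio α) R hR
        exact ⟨R', Weak.of_pStep_imp (fun _ _ => .sumR _) h1, h2⟩
    | delta =>
      obtain ⟨hR, hP, hQ⟩ := dStep_sum_iff.1 hR
      have hP' := Cong.stable h hP
      have hQ' := Cong.stable h' hQ
      obtain hR | hR := hR
      · obtain ⟨R', h1, h2⟩ := h.1 Act.delta R hR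
        obtain ⟨R1, h3, h4⟩ := Weak.exists_dStep h1 hP'
        exact ⟨R', ⟨_, R1, .refl, DStep.sumL h3 hQ', h4⟩, h2⟩
      · obtain ⟨R', h1, h2⟩ := h'.1 Act.delta R hR
        obtain ⟨R1, h3, h4⟩ := Weak.exists_dStep h1 hQ'
        exact ⟨R', ⟨_, R1, .refl, DStep.sumR h3 hP', h4⟩, h2⟩
  refine ⟨key h h', fun γ R hR => ?_⟩
  obtain ⟨R', h1, h2⟩ := key h.symm h'.symm γ R hR
  exact ⟨R', h1, h2.symm⟩

/-! ### Congruence of recursion -/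

theorem inst_mu_unfold (H M : Expr A) :
    inst (subst (liftSubst (instSubst M)) H) (mu (subst (liftSubst (instSubst M)) H)) =
      inst (inst H (mu H)) M :=
  (subst_unfold (instSubst M) H).symm

/-- Induction on the derivation, for all contexts `G` at once. Only `G = var 0` uses `hN`: unfolding
`mu B` turns the context into `B`, and the answer of `inst B N` is transferred to `N`. -/
theorem pStep_context_simulation {B N : Expr A} (hN : Cong N (inst B N)) {P P' : Expr A}
    {α : PAct A} (h : PStep P α P') : ∀ G, P = inst G (mu B) → ∃ H Q', P' = inst H (mu B) ∧
      Weak Step (inst G N) (Act.prio α) Q' ∧ Bisim (inst H N) Q' := by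
  induction h with
  | pre α P =>
    intro G hG
    match G with
    | .pre γ G =>
      simp only [inst, subst, Expr.pre.injEq] at hG
      obtain ⟨rfl, rfl⟩ := hG
      exact ⟨G, inst G N, rfl, .single (PStep.pre _ _), .refl _⟩
    | .var (k + 1) => simp [inst, subst, instSubst] at hG
    | .var 0 => simp [inst, subst, instSubst] at hG
  | sumL Q _ ih =>
    intro G hG
    match G with
    | .sum G G' =>
      simp only [inst, subst, Expr.sum.injEq] at hG
      obtain ⟨H, Q', h1, h2, h3⟩ := ih G hG.1
      exact ⟨H, Q', h1, Weak.of_pStep_imp (fun _ _ => .sumL _) h2, h3⟩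
    | .var (k + 1) => simp [inst, subst, instSubst] at hG
    | .var 0 => simp [inst, subst, instSubst] at hG
  | sumR Q _ ih =>
    intro G hG
    match G with
    | .sum G G' =>
      simp only [inst, subst, Expr.sum.injEq] at hG
      obtain ⟨H, Q', h1, h2, h3⟩ := ih G' hG.2
      exact ⟨H, Q', h1, Weak.of_pStep_imp (fun _ _ => .sumR _) h2, h3⟩
    | .var (k + 1) => simp [inst, subst, instSubst] at hG
    | .var 0 => simp [inst, subst, instSubst] at hG
  | mu _ ih =>
    intro G hG
    match G with
    | .mu G =>
      simp only [inst, subst, Expr.mu.injEq] at hG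
      subst hG
      obtain ⟨H, Q', h1, h2, h3⟩ := ih _ (inst_mu_unfold _ _)
      rw [← inst_mu_unfold] at h2
      exact ⟨H, Q', h1, Weak.of_pStep_imp (fun _ _ => .mu) h2, h3⟩
    | .var (k + 1) => simp [inst, subst, instSubst] at hG
    | .var 0 =>
      simp only [inst, subst, instSubst, Expr.mu.injEq] at hG
      subst hG
      obtain ⟨H, Q', h1, h2, h3⟩ := ih _ rfl
      obtain ⟨Q'', h4, h5⟩ := hN.symm.weak h2
      exact ⟨H, Q'', h1, h4, h3.trans h5⟩
  | pri _ ih =>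
    intro G hG
    match G with
    | .pri G =>
      simp only [inst, subst, Expr.pri.injEq] at hG
      obtain ⟨H, Q', h1, h2, h3⟩ := ih G hG
      exact ⟨H, Q', h1, Weak.of_pStep_imp (fun _ _ => .pri) h2, h3⟩
    | .var (k + 1) => simp [inst, subst, instSubst] at hG
    | .var 0 => simp [inst, subst, instSubst] at hG

/-- The negative premises require that stability transfers, which is therefore assumed. Stability
also forces a weak δ-answer to begin with the δ-step itself, so that the answer survives inside a
choice. -/
theorem dStep_context_simulation {B N : Expr A} (hN : Cong N (inst B N))
    (hs : ∀ G, Stable (inst G (mu B)) → Stable (inst G N)) {P P' : Expr A}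
    (h : DStep P P') : ∀ G, P = inst G (mu B) → ∃ H Q', P' = inst H (mu B) ∧
      Weak Step (inst G N) Act.delta Q' ∧ Bisim (inst H N) Q' := by
  induction h with
  | pre P =>
    intro G hG
    match G with
    | .pre γ G =>
      simp only [inst, subst, Expr.pre.injEq] at hG
      obtain ⟨rfl, rfl⟩ := hG
      exact ⟨G, inst G N, rfl, .single (DStep.pre _), .refl _⟩
    | .var (k + 1) => simp [inst, subst, instSubst] at hG
    | .var 0 => simp [inst, subst, instSubst] at hG
  | sumL h hQ ih =>
    intro G hG
    match G with
    | .sum G G' =>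
      simp only [inst, subst, Expr.sum.injEq] at hG
      obtain ⟨rfl, rfl⟩ := hG
      obtain ⟨H, Q', h1, h2, h3⟩ := ih G rfl
      obtain ⟨R, h4, h5⟩ := Weak.exists_dStep h2 (hs G h.stable)
      exact ⟨H, Q', h1, ⟨_, R, .refl, DStep.sumL h4 (hs G' hQ), h5⟩, h3⟩
    | .var (k + 1) => simp [inst, subst, instSubst] at hG
    | .var 0 => simp [inst, subst, instSubst] at hG
  | sumR h hQ ih =>
    intro G hG
    match G with
    | .sum G G' =>
      simp only [inst, subst, Expr.sum.injEq] at hG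
      obtain ⟨rfl, rfl⟩ := hG
      obtain ⟨H, Q', h1, h2, h3⟩ := ih G' rfl
      obtain ⟨R, h4, h5⟩ := Weak.exists_dStep h2 (hs G' h.stable)
      exact ⟨H, Q', h1, ⟨_, R, .refl, DStep.sumR h4 (hs G hQ), h5⟩, h3⟩
    | .var (k + 1) => simp [inst, subst, instSubst] at hG
    | .var 0 => simp [inst, subst, instSubst] at hG
  | mu h ih =>
    intro G hG
    match G with
    | .mu G =>
      simp only [inst, subst, Expr.mu.injEq] at hG
      subst hG
      have hst := hs _ ((inst_mu_unfold G _) ▸ h.stable)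
      obtain ⟨H, Q', h1, h2, h3⟩ := ih _ (inst_mu_unfold _ _)
      obtain ⟨R, h4, h5⟩ := Weak.exists_dStep h2 hst
      rw [← inst_mu_unfold] at h4
      exact ⟨H, Q', h1, ⟨_, R, .refl, DStep.mu h4, h5⟩, h3⟩
    | .var (k + 1) => simp [inst, subst, instSubst] at hG
    | .var 0 =>
      simp only [inst, subst, instSubst, Expr.mu.injEq] at hG
      subst hG
      obtain ⟨H, Q', h1, h2, h3⟩ := ih _ rfl
      obtain ⟨Q'', h4, h5⟩ := hN.symm.weak h2
      exact ⟨H, Q'', h1, h4, h3.trans h5⟩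

/-- Two recursions, each of which solves the equation of the other, are congruent. -/
theorem cong_mu_of_solves {B C : Expr A} (hB : Cong (mu C) (inst B (mu C)))
    (hC : Cong (mu B) (inst C (mu B))) : Cong (mu B) (mu C) := by
  -- The prioritized simulation in the opposite direction answers a τ by at least one τ, so
  -- stability transfers.
  have hst : ∀ {B C : Expr A}, Cong (mu B) (inst C (mu B)) → ∀ G,
      Stable (inst G (mu B)) → Stable (inst G (mu C)) := by
    rintro B C hC G hG ⟨Q, hQ⟩
    obtain ⟨_, _, _, h, _⟩ := pStep_context_simulation hC hQ G rfl
    exact Weak.not_stable h hG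
  have key : ∀ {B C : Expr A}, Cong (mu C) (inst B (mu C)) → Cong (mu B) (inst C (mu B)) →
      ∀ G γ P', Step (inst G (mu B)) γ P' → ∃ H Q', P' = inst H (mu B) ∧
        Weak Step (inst G (mu C)) γ Q' ∧ Bisim (inst H (mu C)) Q' := by
    intro B C hB hC G γ P' h
    cases γ with
    | prio α => exact pStep_context_simulation hB h G rfl
    | delta => exact dStep_context_simulation hB (hst hC) h G rfl
  have hbis : ∀ G, Bisim (inst G (mu B)) (inst G (mu C)) := by
    intro G
    refine WeakBisimilar.of_upTo
      (β := fun P Q => ∃ G, P = inst G (mu B) ∧ Q = inst G (mu C)) ?_ ?_ ⟨G, rfl, rfl⟩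
    · rintro _ _ ⟨G, rfl, rfl⟩ γ P' h
      obtain ⟨H, Q', rfl, h2, h3⟩ := key hB hC G γ P' h
      exact ⟨Q', _, h2.weakHat, ⟨H, rfl, rfl⟩, h3⟩
    · rintro _ _ ⟨G, rfl, rfl⟩ γ P' h
      obtain ⟨H, Q', rfl, h2, h3⟩ := key hC hB G γ P' h
      exact ⟨Q', _, h2.weakHat, ⟨H, rfl, rfl⟩, h3⟩
  constructor
  · intro γ P' h
    obtain ⟨H, Q', rfl, h2, h3⟩ := key hB hC (var 0) γ P' h
    exact ⟨Q', h2, (hbis H).trans h3⟩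
  · intro γ P' h
    obtain ⟨H, Q', rfl, h2, h3⟩ := key hC hB (var 0) γ P' h
    exact ⟨Q', h2, h3.symm.trans (hbis H)⟩

/-! ### Soundness of the axioms used for normalisation -/

theorem cong_sum_comm (P Q : Expr A) : Cong (sum P Q) (sum Q P) :=
  cong_of_iff (fun _ _ => by simp only [pStep_sum_iff, or_comm])
    fun _ => by simp only [dStep_sum_iff, or_comm, and_comm]

theorem cong_sum_assoc (P Q R : Expr A) : Cong (sum (sum P Q) R) (sum P (sum Q R)) :=
  cong_of_iff (fun _ _ => by simp only [pStep_sum_iff, or_assoc])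
    fun _ => by simp only [dStep_sum_iff, stable_sum_iff]; tauto

theorem cong_sum_self (P : Expr A) : Cong (sum P P) P :=
  cong_of_iff (fun _ _ => by simp only [pStep_sum_iff, or_self])
    fun R => by
      simp only [dStep_sum_iff, or_self, and_self]
      exact ⟨And.left, fun h => ⟨h, h.stable⟩⟩

theorem cong_sum_nil (P : Expr A) : Cong (sum P nil) P :=
  cong_of_iff (fun _ _ => by simp only [pStep_sum_iff, not_pStep_nil, or_false])
    fun R => by
      simp only [dStep_sum_iff, not_dStep_nil, or_false]
      exact ⟨And.left, fun h => ⟨h, h.stable, fun ⟨_, h⟩ => not_pStep_nil h⟩⟩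

theorem cong_sum_tau (P : Expr A) : Cong (sum P (tau P)) (tau P) := by
  constructor
  · intro γ R h
    cases γ with
    | prio α =>
      obtain h | h := pStep_sum_iff.1 h
      · exact ⟨R, (Weak.single h).prepend (.single (PStep.pre _ P)), .refl R⟩
      · exact ⟨R, .single h, .refl R⟩
    | delta => exact ((dStep_sum_iff.1 h).2.2 ⟨P, .pre _ P⟩).elim
  · intro γ R h
    cases γ with
    | prio α => exact ⟨R, .single (PStep.sumR _ h), .refl R⟩
    | delta => cases h

theorem cong_pri_nil : Cong (pri nil : Expr A) nil :=
  cong_of_iff (fun _ _ => pStep_pri_iff) fun _ => by simp only [not_dStep_pri, not_dStep_nil]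

theorem cong_pri_prio (α : PAct A) (P : Expr A) :
    Cong (pri (pre (Act.prio α) P)) (pre (Act.prio α) P) :=
  cong_of_iff (fun _ _ => pStep_pri_iff) fun _ => by simp [not_dStep_pri, dStep_pre_iff]

theorem cong_pri_delta (P : Expr A) : Cong (pri (pre Act.delta P)) nil :=
  cong_of_iff (fun _ _ => by simp [pStep_pri_iff, pStep_pre_iff, not_pStep_nil])
    fun _ => by simp only [not_dStep_pri, not_dStep_nil]

theorem cong_pri_sum (P Q : Expr A) : Cong (pri (sum P Q)) (sum (pri P) (pri Q)) :=
  cong_of_iff (fun _ _ => by simp only [pStep_pri_iff, pStep_sum_iff])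
    fun _ => by simp only [dStep_sum_iff, not_dStep_pri, or_self, false_and]

theorem cong_pri_pri (P : Expr A) : Cong (pri (pri P)) (pri P) :=
  cong_of_iff (fun _ _ => pStep_pri_iff) fun _ => by simp only [not_dStep_pri]

theorem cong_tau_sum_pri (P Q : Expr A) : Cong (sum (tau P) Q) (sum (tau P) (pri Q)) :=
  cong_of_iff (fun _ _ => by simp only [pStep_pri_iff, pStep_sum_iff])
    fun _ => by simp only [not_dStep_tau_sum]

theorem Cong.mu {E F : Expr A} (h : ∀ M, Cong (inst E M) (inst F M)) : Cong (mu E) (mu F) :=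
  cong_mu_of_solves ((cong_unfold F).trans (h _).symm) ((cong_unfold E).trans (h _))

theorem pStep_mu_var_sum {E M R : Expr A} {α : PAct A} (hM : M = Expr.mu (sum (var 0) E)) :
    PStep M α R ↔ PStep (inst E M) α R := by
  refine ⟨fun h => ?_, fun h => by subst hM; exact .mu (.sumR _ h)⟩
  -- A derivation from `M` runs through these two shapes only, until it takes the right summand; the
  -- induction has to cover both.
  have key : ∀ {P R : Expr A} {α : PAct A}, PStep P α R → P = M ∨ P = sum M (inst E M) →
      PStep (inst E M) α R := by
    intro P R α h
    induction h with
    | mu _ ih =>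
      rintro (h | h)
      · rw [hM, Expr.mu.injEq] at h
        subst h
        exact ih (.inr (by rw [← hM]; simp only [inst, subst, instSubst]))
      · cases h
    | sumL _ _ ih =>
      rintro (h | h)
      · rw [hM] at h; cases h
      · cases h; exact ih (.inl rfl)
    | sumR _ h' _ =>
      rintro (h | h)
      · rw [hM] at h; cases h
      · cases h; exact h'
    | pre => rintro (h | h) <;> rw [hM] at h <;> cases h
    | pri => rintro (h | h) <;> rw [hM] at h <;> cases h
  exact key h (.inl rfl)

theorem dStep_mu_var_sum {E M R : Expr A} (hM : M = Expr.mu (sum (var 0) E)) :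
    DStep M R ↔ DStep (inst E M) R := by
  constructor
  · intro h
    have key : ∀ {P R : Expr A}, DStep P R → P = M ∨ P = sum M (inst E M) →
        DStep (inst E M) R := by
      intro P R h
      induction h with
      | mu _ ih =>
        rintro (h | h)
        · rw [hM, Expr.mu.injEq] at h
          subst h
          exact ih (.inr (by rw [← hM]; simp only [inst, subst, instSubst]))
        · cases h
      | sumL _ _ ih =>
        rintro (h | h)
        · rw [hM] at h; cases h
        · cases h; exact ih (.inl rfl)
      | sumR h' _ _ =>
        rintro (h | h)
        · rw [hM] at h; cases h
        · cases h; exact h'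
      | pre => rintro (h | h) <;> rw [hM] at h <;> cases h
    exact key h (.inl rfl)
  · intro h
    have hs : Stable M := by
      rintro ⟨Q, hQ⟩
      exact h.stable ⟨Q, (pStep_mu_var_sum hM).1 hQ⟩
    have : DStep (sum M (inst E M)) R := .sumR h hs
    rw [hM]
    rw [hM] at this
    exact .mu this

theorem cong_ung1 (E : Expr A) : Cong (mu (sum (var 0) E)) (mu E) := by
  refine cong_mu_of_solves ?_ ?_
  · exact (cong_sum_self _).symm.trans (Cong.sum (.refl _) (cong_unfold E))
  · exact cong_of_iff (fun _ _ => pStep_mu_var_sum rfl) fun _ => dStep_mu_var_sum rfl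

theorem bisim_tau (P : Expr A) : Bisim (tau P) P := by
  refine .of_weakHat (fun γ R h => ?_) fun γ R h => ?_
  · cases γ with
    | prio α =>
      obtain ⟨hα, rfl⟩ := pStep_pre_iff.1 h
      rw [← hα]
      exact ⟨R, .refl R, .inr (.refl R)⟩
    | delta => cases h
  · exact ⟨R, (Weak.single h).weakHat.prepend (.single (PStep.pre _ P)), .refl R⟩

/-- Two expressions without `δ`-transitions are congruent if they match each other's
prioritized transitions. -/
theorem cong_of_not_dStep {P Q : Expr A} (hP : ∀ R, ¬ DStep P R) (hQ : ∀ R, ¬ DStep Q R)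
    (h : ∀ α R, PStep P α R → ∃ R', Weak Step Q (Act.prio α) R' ∧ Bisim R R')
    (h' : ∀ α R, PStep Q α R → ∃ R', Weak Step P (Act.prio α) R' ∧ Bisim R' R) : Cong P Q := by
  constructor
  · intro γ R hR
    cases γ with
    | prio α => exact h α R hR
    | delta => exact (hP R hR).elim
  · intro γ R hR
    cases γ with
    | prio α => exact h' α R hR
    | delta => exact (hQ R hR).elim

/-- Bisimilarity ignores the divergence of the loop, so one τ in front of `E` can replace it. The
loop also blocks every δ of `E`, which `pri` has to reproduce. -/
theorem cong_ung2 (E : Expr A) : Cong (mu (sum (tau (var 0)) E)) (mu (tau (pri E))) := by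
  refine cong_mu_of_solves ?_ ?_
  · set N := mu (tau (pri E)) with hN
    have hN' : Cong N (tau (pri (inst E N))) := cong_unfold _
    have hb : Bisim N (pri (inst E N)) := hN'.weakBisimilar.trans (bisim_tau _)
    refine hN'.trans (cong_of_not_dStep (fun _ h => by cases h)
      (fun _ => not_dStep_tau_sum) (fun α R h => ?_) fun α R h => ?_)
    · obtain ⟨hα, rfl⟩ := pStep_pre_iff.1 h
      rw [← hα]
      exact ⟨N, .single (PStep.sumL _ (.pre _ N)), hb.symm⟩
    · obtain h | h := pStep_sum_iff.1 h
      · obtain ⟨hα, rfl⟩ := pStep_pre_iff.1 h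
        rw [← hα]
        exact ⟨_, .single (PStep.pre _ _), hb.symm⟩
      · exact ⟨R, (Weak.single (PStep.pri h)).prepend (.single (PStep.pre _ _)), .refl R⟩
  · set M := mu (sum (tau (var 0)) E) with hM
    have hMτ : PStep M PAct.tau M := .mu (.sumL _ (.pre _ _))
    have hE : ∀ α R, PStep (inst E M) α R → PStep M α R := fun α R h => .mu (.sumR _ h)
    have hMi : ∀ α R, PStep M α R → (α = PAct.tau ∧ R = M) ∨ PStep (inst E M) α R := by
      intro α R h
      rw [hM, pStep_mu_iff] at h
      obtain h | h := pStep_sum_iff.1 h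
      · obtain ⟨hα, rfl⟩ := pStep_pre_iff.1 h
        cases hα
        exact .inl ⟨rfl, rfl⟩
      · exact .inr h
    have hMd : ∀ R, ¬ DStep M R := fun R h => h.stable ⟨M, hMτ⟩
    have hb : Bisim M (pri (inst E M)) := by
      refine .of_weakHat (fun γ R h => ?_) fun γ R h => ?_
      · cases γ with
        | prio α =>
          obtain ⟨rfl, rfl⟩ | h := hMi α R h
          · exact ⟨_, .refl _, .inl ⟨rfl, rfl⟩⟩
          · exact ⟨R, (Weak.single (PStep.pri h)).weakHat, .inr (.refl R)⟩
        | delta => exact (hMd R h).elim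
      · cases γ with
        | prio α => exact ⟨R, (Weak.single (hE α R (pStep_pri_iff.1 h))).weakHat, .refl R⟩
        | delta => cases h
    refine cong_of_not_dStep hMd (fun R h => by cases h) (fun α R h => ?_) fun α R h => ?_
    · obtain ⟨rfl, rfl⟩ | h := hMi α R h
      · exact ⟨_, .single (PStep.pre _ _), hb⟩
      · exact ⟨R, (Weak.single (PStep.pri h)).prepend (.single (PStep.pre _ _)), .refl R⟩
    · obtain ⟨hα, rfl⟩ := pStep_pre_iff.1 h
      cases hα
      exact ⟨M, .single hMτ, hb⟩

/-- The common content of the two axioms that move the summands of an expression `τ.(X + E)` or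
`τ.(pri(X) + E)` out of the prefix. -/
theorem cong_ung_of_pStep_iff {C E F : Expr A}
    (hC : ∀ M α R, PStep (inst C M) α R ↔ PStep M α R ∨ PStep (inst E M) α R)
    (hd : ∀ M R, ¬ Stable M → ¬ DStep (inst C M) R) :
    Cong (mu (sum (tau C) F)) (mu (sum (sum (tau (var 0)) E) F)) := by
  refine cong_mu_of_solves ?_ ?_
  · set N := mu (sum (sum (tau (var 0)) E) F) with hN
    have hN' : Cong N (sum (sum (tau N) (inst E N)) (inst F N)) := cong_unfold _
    have hNτ : PStep N PAct.tau N := .mu (.sumL _ (.sumL _ (.pre _ _)))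
    have hE : ∀ α R, PStep (inst E N) α R → PStep N α R := fun α R h =>
      .mu (.sumL _ (.sumR _ h))
    have hF : ∀ α R, PStep (inst F N) α R → PStep N α R := fun α R h => .mu (.sumR _ h)
    have hCN : ∀ α R, PStep (inst C N) α R ↔ PStep N α R := fun α R =>
      (hC N α R).trans ⟨fun h => h.elim id (hE α R), .inl⟩
    have hNd : ∀ R, ¬ DStep N R := fun R h => h.stable ⟨N, hNτ⟩
    have hb : Cong (inst C N) N := cong_of_iff hCN fun R => by
      simp only [hNd, hd N R fun h => h ⟨N, hNτ⟩]
    refine cong_of_not_dStep hNd (fun _ => not_dStep_tau_sum) (fun α R h => ?_) fun α R h => ?_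
    · rw [hN, pStep_mu_iff] at h
      obtain h | h := pStep_sum_iff.1 h
      · obtain h | h := pStep_sum_iff.1 h
        · obtain ⟨hα, rfl⟩ := pStep_pre_iff.1 h
          cases hα
          exact ⟨_, .single (PStep.sumL _ (.pre _ _)), hb.symm.weakBisimilar⟩
        · exact ⟨R, (Weak.single ((hCN α R).2 (hE α R h))).prepend
            (.single (PStep.sumL _ (.pre _ _))), .refl R⟩
      · exact ⟨R, .single (PStep.sumR _ h), .refl R⟩
    · obtain h | h := pStep_sum_iff.1 h
      · obtain ⟨hα, rfl⟩ := pStep_pre_iff.1 h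
        cases hα
        exact ⟨N, .single hNτ, hb.symm.weakBisimilar⟩
      · exact ⟨R, .single (hF α R h), .refl R⟩
  · set M := mu (sum (tau C) F) with hM
    have hMτ : PStep M PAct.tau (inst C M) := .mu (.sumL _ (.pre _ _))
    have hMd : ∀ R, ¬ DStep M R := fun R h => h.stable ⟨_, hMτ⟩
    have hE : ∀ α R, PStep (inst E M) α R → Weak Step M (Act.prio α) R := fun α R h =>
      (Weak.single ((hC M α R).2 (.inr h))).prepend (.single hMτ)
    have hCd : ∀ R, ¬ DStep (inst C M) R := fun R => hd M R fun h => h ⟨_, hMτ⟩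
    have hb : Cong M (inst C M) := by
      refine cong_of_not_dStep hMd hCd (fun α R h => ?_) fun α R h => ?_
      · exact ⟨R, .single ((hC M α R).2 (.inl h)), .refl R⟩
      · obtain h | h := (hC M α R).1 h
        · exact ⟨R, .single h, .refl R⟩
        · exact ⟨R, hE α R h, .refl R⟩
    refine cong_of_not_dStep hMd (fun R h => ?_) (fun α R h => ?_) fun α R h => ?_
    · exact h.stable ⟨M, .sumL _ (.sumL _ (.pre _ _))⟩
    · rw [hM, pStep_mu_iff] at h
      obtain h | h := pStep_sum_iff.1 h
      · obtain ⟨hα, rfl⟩ := pStep_pre_iff.1 h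
        cases hα
        exact ⟨M, .single (PStep.sumL _ (.sumL _ (.pre _ _))), hb.symm.weakBisimilar⟩
      · exact ⟨R, .single (PStep.sumR _ h), .refl R⟩
    · obtain h | h := pStep_sum_iff.1 h
      · obtain h | h := pStep_sum_iff.1 h
        · obtain ⟨hα, rfl⟩ := pStep_pre_iff.1 h
          cases hα
          exact ⟨_, .single hMτ, hb.symm.weakBisimilar⟩
        · exact ⟨R, hE α R h, .refl R⟩
      · exact ⟨R, .single (PStep.mu (.sumR _ h)), .refl R⟩

theorem cong_ung3 (E F : Expr A) :
    Cong (mu (sum (tau (sum (var 0) E)) F)) (mu (sum (sum (tau (var 0)) E) F)) :=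
  cong_ung_of_pStep_iff (fun _ _ _ => pStep_sum_iff) fun _ _ h h' => h (dStep_sum_iff.1 h').2.1

theorem cong_ung4 (E F : Expr A) :
    Cong (mu (sum (tau (sum (pri (var 0)) E)) F)) (mu (sum (sum (tau (var 0)) E) F)) :=
  cong_ung_of_pStep_iff (fun _ _ _ => pStep_sum_iff.trans (or_congr_left pStep_pri_iff))
    fun _ _ h h' => h fun ⟨Q, hQ⟩ => (dStep_sum_iff.1 h').2.1 ⟨Q, .pri hQ⟩

/-! ### Provable equations that are known to be sound -/

/-- All instances of the equation are derivable and hold up to observational congruence. -/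
def Eqv (E F : Expr A) : Prop :=
  ∀ σ, Provable (subst σ E) (subst σ F) ∧ Cong (subst σ E) (subst σ F)

namespace Eqv

variable {E F G E' F' : Expr A}

theorem refl (E : Expr A) : Eqv E E := fun _ => ⟨.refl _, .refl _⟩

theorem symm (h : Eqv E F) : Eqv F E := fun σ => ⟨.symm (h σ).1, (h σ).2.symm⟩

theorem trans (h : Eqv E F) (h' : Eqv F G) : Eqv E G := fun σ =>
  ⟨.trans (h σ).1 (h' σ).1, (h σ).2.trans (h' σ).2⟩

theorem pre (γ : Act A) (h : Eqv E F) : Eqv (pre γ E) (pre γ F) := fun σ =>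
  ⟨.congrPre γ (h σ).1, Cong.pre γ (h σ).2⟩

theorem sum (h : Eqv E E') (h' : Eqv F F') : Eqv (sum E F) (sum E' F') := fun σ =>
  ⟨.congrSum (h σ).1 (h' σ).1, Cong.sum (h σ).2 (h' σ).2⟩

/-- The quantification over substitutions pays off here: the bodies must be congruent for every
value of the bound variable, and such a value merely extends `σ`. -/
theorem mu (h : Eqv E F) : Eqv (mu E) (mu F) := fun σ =>
  ⟨.congrMu (h _).1, Cong.mu fun M => by
    simpa only [inst_subst_liftSubst] using (h (consSubst M σ)).2⟩

theorem sum_comm (E F : Expr A) : Eqv (E.sum F) (F.sum E) := fun _ =>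
  ⟨.A1 _ _, cong_sum_comm _ _⟩

theorem sum_assoc (E F G : Expr A) : Eqv ((E.sum F).sum G) (E.sum (F.sum G)) := fun _ =>
  ⟨.A2 _ _ _, cong_sum_assoc _ _ _⟩

theorem sum_self (E : Expr A) : Eqv (E.sum E) E := fun _ => ⟨.A3 _, cong_sum_self _⟩

theorem sum_nil (E : Expr A) : Eqv (E.sum nil) E := fun _ => ⟨.A4 _, cong_sum_nil _⟩

theorem sum_tau (E : Expr A) : Eqv (E.sum (tau E)) (tau E) := fun _ =>
  ⟨.Tau2 _, cong_sum_tau _⟩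

theorem pri_nil : Eqv (Expr.pri nil : Expr A) nil := fun _ => ⟨.Pri1, cong_pri_nil⟩

theorem pri_prio (α : PAct A) (E : Expr A) :
    Eqv (Expr.pri (Expr.pre (Act.prio α) E)) (Expr.pre (Act.prio α) E) := fun _ =>
  ⟨.Pri2 _ _, cong_pri_prio _ _⟩

theorem pri_delta (E : Expr A) : Eqv (Expr.pri (Expr.pre Act.delta E)) nil := fun _ =>
  ⟨.Pri3 _, cong_pri_delta _⟩

theorem pri_sum (E F : Expr A) : Eqv (E.sum F).pri (E.pri.sum F.pri) := fun _ =>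
  ⟨.Pri4 _ _, cong_pri_sum _ _⟩

theorem tau_sum_pri (E F : Expr A) : Eqv ((tau E).sum F) ((tau E).sum F.pri) := fun _ =>
  ⟨.Pri6 _ _, cong_tau_sum_pri _ _⟩

theorem unfold (E : Expr A) : Eqv (Expr.mu E) (inst E (Expr.mu E)) := fun σ => by
  rw [subst_unfold]
  exact ⟨.Rec1 _, cong_unfold _⟩

theorem ung1 (E : Expr A) : Eqv (Expr.mu ((var 0).sum E)) (Expr.mu E) := fun _ =>
  ⟨.Ung1 _, cong_ung1 _⟩

theorem ung2 (E : Expr A) :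
    Eqv (Expr.mu ((tau (var 0)).sum E)) (Expr.mu (tau E.pri)) := fun _ =>
  ⟨.Ung2 _, cong_ung2 _⟩

theorem ung3 (E F : Expr A) : Eqv (Expr.mu ((tau ((var 0).sum E)).sum F))
    (Expr.mu (((tau (var 0)).sum E).sum F)) := fun _ =>
  ⟨.Ung3 _ _, cong_ung3 _ _⟩

theorem ung4 (E F : Expr A) : Eqv (Expr.mu ((tau ((var 0).pri.sum E)).sum F))
    (Expr.mu (((tau (var 0)).sum E).sum F)) := fun _ =>
  ⟨.Ung4 _ _, cong_ung4 _ _⟩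

end Eqv

/-! ### Guardedness under renaming and substitution -/

theorem guarded_rename {k : ℕ} {ρ : ℕ → ℕ} {E : Expr A} (h : ∀ j, ρ j = k → Guarded j E) :
    Guarded k (rename ρ E) := by
  induction E generalizing k ρ with
  | nil => trivial
  | var j => exact fun hj => h j hj rfl
  | pre γ E ih =>
    by_cases hγ : γ = Act.tau
    · exact Or.inr (ih fun j hj => (h j hj).resolve_left fun h => h hγ)
    · exact Or.inl hγ
  | sum E F ihE ihF => exact ⟨ihE fun j hj => (h j hj).1, ihF fun j hj => (h j hj).2⟩
  | mu E ih =>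
    refine ih fun j hj => ?_
    cases j with
    | zero => simp [liftRen] at hj
    | succ j => exact h j (by simpa [liftRen] using hj)
  | pri E ih => exact ih h

theorem guarded_subst {k : ℕ} {σ : ℕ → Expr A} {E : Expr A}
    (h : ∀ j, ¬ Guarded j E → Guarded k (σ j)) : Guarded k (subst σ E) := by
  induction E generalizing k σ with
  | nil => trivial
  | var j => exact h j fun h => h rfl
  | pre γ E ih =>
    by_cases hγ : γ = Act.tau
    · exact Or.inr (ih fun j hj => h j fun h => hj (h.resolve_left fun h => h hγ))
    · exact Or.inl hγ
  | sum E F ihE ihF =>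
    exact ⟨ihE fun j hj => h j fun h => hj h.1, ihF fun j hj => h j fun h => hj h.2⟩
  | mu E ih =>
    refine ih fun j hj => ?_
    cases j with
    | zero => exact Nat.zero_ne_add_one k
    | succ j => exact guarded_rename fun i hi => by cases hi; exact h j hj
  | pri E ih => exact ih h

theorem guarded_subst_liftSubst {σ : ℕ → Expr A} {E : Expr A} (h : Guarded 0 E) :
    Guarded 0 (subst (liftSubst σ) E) :=
  guarded_subst fun j hj => by
    cases j with
    | zero => exact (hj h).elim
    | succ j => exact guarded_rename fun i hi => (Nat.succ_ne_zero i hi).elim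

/-- In every recursion that occurs in the expression, the bound variable is strongly guarded. -/
def AllGuarded : Expr A → Prop
  | nil => True
  | var _ => True
  | pre _ E => AllGuarded E
  | sum E F => AllGuarded E ∧ AllGuarded F
  | mu E => Guarded 0 E ∧ AllGuarded E
  | pri E => AllGuarded E

theorem AllGuarded.rename {E : Expr A} (h : AllGuarded E) (ρ : ℕ → ℕ) :
    AllGuarded (rename ρ E) := by
  induction E generalizing ρ with
  | nil => trivial
  | var => trivial
  | pre γ E ih => exact ih h ρ
  | sum E F ihE ihF => exact ⟨ihE h.1 ρ, ihF h.2 ρ⟩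
  | mu E ih =>
    refine ⟨guarded_rename fun j hj => ?_, ih h.2 _⟩
    cases j with
    | zero => exact h.1
    | succ j => simp [liftRen] at hj
  | pri E ih => exact ih h ρ

theorem AllGuarded.subst {E : Expr A} (h : AllGuarded E) {σ : ℕ → Expr A}
    (hσ : ∀ k, AllGuarded (σ k)) : AllGuarded (subst σ E) := by
  induction E generalizing σ with
  | nil => trivial
  | var => exact hσ _
  | pre γ E ih => exact ih h hσ
  | sum E F ihE ihF => exact ⟨ihE h.1 hσ, ihF h.2 hσ⟩
  | mu E ih =>
    refine ⟨guarded_subst_liftSubst h.1, ih h.2 fun k => ?_⟩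
    cases k with
    | zero => trivial
    | succ k => exact (hσ k).rename _
  | pri E ih => exact ih h hσ

theorem AllGuarded.inst {E F : Expr A} (hE : AllGuarded E) (hF : AllGuarded F) :
    AllGuarded (inst E F) :=
  hE.subst fun k => by
    cases k with
    | zero => exact hF
    | succ k => trivial

/-! ### Flat expressions -/

/-- Expressions with guarded recursion in which no recursion is reached before a visible prefix.
Variables under `pri` are allowed below `τ`, and at the top if `b` is `true`. -/
inductive Flat : Bool → Expr A → Prop
  | nil (b : Bool) : Flat b nil
  | var (b : Bool) (k : ℕ) : Flat b (var k)
  | priVar (k : ℕ) : Flat true (pri (var k))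
  | tau (b : Bool) {E : Expr A} : Flat true E → Flat b (tau E)
  | pre (b : Bool) {γ : Act A} {E : Expr A} : γ ≠ Act.tau → AllGuarded E → Flat b (pre γ E)
  | sum {b : Bool} {E F : Expr A} : Flat b E → Flat b F → Flat b (sum E F)

theorem Flat.weaken {b : Bool} {E : Expr A} (h : Flat b E) : Flat true E := by
  induction h with
  | nil => exact .nil _
  | var => exact .var _ _
  | priVar => exact .priVar _
  | tau _ h => exact .tau _ h
  | pre _ h h' => exact .pre _ h h'
  | sum _ _ ihE ihF => exact .sum ihE ihF

theorem Flat.allGuarded {b : Bool} {E : Expr A} (h : Flat b E) : AllGuarded E := by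
  induction h with
  | nil => trivial
  | var => trivial
  | priVar => trivial
  | tau _ _ ih => exact ih
  | pre _ _ h => exact h
  | sum _ _ ihE ihF => exact ⟨ihE, ihF⟩

/-- Guardedness confines the inserted expression to positions below prefixes other than τ, where
flatness asks only for guarded recursion. -/
theorem Flat.inst {b : Bool} {E F : Expr A} (h : Flat b E) (hE : Guarded 0 E)
    (hF : AllGuarded F) : Flat b (inst E F) := by
  induction h with
  | nil => exact .nil _
  | var b k =>
    cases k with
    | zero => exact (hE rfl).elim
    | succ k => exact .var _ _
  | priVar k =>
    cases k with
    | zero => exact (hE rfl).elim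
    | succ k => exact .priVar _
  | tau _ _ ih => exact .tau _ (ih (hE.resolve_left fun h => h rfl))
  | pre _ h h' => exact .pre _ h (h'.inst hF)
  | sum _ _ ihE ihF => exact .sum (ihE hE.1) (ihF hE.2)

/-- The axioms push `pri` down to prefixes, where it disappears, and to variables, where it gets
stuck; hence the flag `true` of the result. -/
theorem Flat.exists_pri {b : Bool} {E : Expr A} (h : Flat b E) (hE : Guarded 0 E) :
    ∃ F, Flat true F ∧ Guarded 0 F ∧ Eqv (pri E) F := by
  induction h with
  | nil => exact ⟨_, .nil _, hE, Eqv.pri_nil⟩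
  | var b k => exact ⟨_, .priVar k, hE, .refl _⟩
  | priVar k => exact ⟨_, .priVar k, hE, fun _ => ⟨.Pri5 _, cong_pri_pri _⟩⟩
  | tau _ h => exact ⟨_, .tau _ h, hE, Eqv.pri_prio _ _⟩
  | @pre _ γ E h h' =>
    cases γ with
    | prio α => exact ⟨_, .pre _ h h', hE, Eqv.pri_prio _ _⟩
    | delta => exact ⟨_, .nil _, trivial, Eqv.pri_delta _⟩
  | sum _ _ ihE ihF =>
    obtain ⟨E', h1, h2, h3⟩ := ihE hE.1
    obtain ⟨F', h4, h5, h6⟩ := ihF hE.2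
    exact ⟨_, .sum h1 h4, ⟨h2, h5⟩, (Eqv.pri_sum _ _).trans (h3.sum h6)⟩

/-! ### Elimination of unguarded occurrences of the bound variable -/

theorem Eqv.of_sum_left {E F G : Expr A} (h : Eqv E (F.sum E)) :
    Eqv (E.sum G) (F.sum (E.sum G)) :=
  (h.sum (.refl _)).trans (.sum_assoc _ _ _)

theorem Eqv.of_sum_right {E F G : Expr A} (h : Eqv E (F.sum E)) :
    Eqv (G.sum E) (F.sum (G.sum E)) :=
  (Eqv.sum_comm _ _).trans (h.of_sum_left.trans ((Eqv.refl _).sum (.sum_comm _ _)))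

/-- A summand of `G` is also a summand of `τ.G`. -/
theorem Eqv.tau_of_sum {F G : Expr A} (h : Eqv G (F.sum G)) : Eqv (tau G) (F.sum (tau G)) := by
  have h1 : Eqv (tau G) ((F.sum G).sum (tau G)) :=
    (Eqv.sum_tau G).symm.trans (h.sum (.refl _))
  exact h1.trans ((Eqv.sum_assoc _ _ _).trans ((Eqv.refl _).sum (.sum_tau G)))

/-- An unguarded occurrence lies only below choices and τ-prefixes, and both pass the summands of
their arguments upwards, the latter by Tau2. -/
theorem Flat.exists_summand {b : Bool} {E : Expr A} (h : Flat b E) (hE : ¬ Guarded 0 E) :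
    Eqv E ((Expr.var 0).sum E) ∨ Eqv E ((Expr.var 0).pri.sum E) := by
  induction h with
  | nil => exact (hE trivial).elim
  | var b k =>
    obtain rfl : k = 0 := not_not.1 hE
    exact .inl (Eqv.sum_self _).symm
  | priVar k =>
    obtain rfl : k = 0 := not_not.1 hE
    exact .inr (Eqv.sum_self _).symm
  | tau _ _ ih => exact (ih fun h => hE (.inr h)).imp Eqv.tau_of_sum Eqv.tau_of_sum
  | pre _ h => exact (hE (.inl h)).elim
  | @sum _ E F _ _ ihE ihF =>
    by_cases h : Guarded 0 E
    · exact (ihF fun h' => hE ⟨h, h'⟩).imp Eqv.of_sum_right Eqv.of_sum_right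
    · exact (ihE h).imp Eqv.of_sum_left Eqv.of_sum_left

/-- A summand `τ.E` in which the bound variable is unguarded can be split into a loop and `E`. -/
theorem Flat.eqv_mu_tau {E : Expr A} (h : Flat true E) (hE : ¬ Guarded 0 E) (F : Expr A) :
    Eqv (mu ((Expr.tau E).sum F)) (mu ((Expr.tau (Expr.var 0)).sum (E.sum F))) := by
  obtain h | h := h.exists_summand hE
  · exact (Eqv.mu ((h.pre _).sum (.refl F))).trans
      ((Eqv.ung3 E F).trans (Eqv.mu (.sum_assoc _ _ _)))
  · exact (Eqv.mu ((h.pre _).sum (.refl F))).trans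
      ((Eqv.ung4 E F).trans (Eqv.mu (.sum_assoc _ _ _)))

theorem Eqv.sum_left_comm (E F G : Expr A) : Eqv (E.sum (F.sum G)) (F.sum (E.sum G)) :=
  (Eqv.sum_assoc _ _ _).symm.trans
    (((Eqv.sum_comm _ _).sum (.refl _)).trans (.sum_assoc _ _ _))

/-- Beside the loop τ.X, Tau2 absorbs X, Pri6 turns pri(Y) back into Y (so the flag returns to
`false`), and a summand τ.E exposing X splits into a second loop and E, on which the induction
continues. The arbitrary remainder `F` allows the summands to be treated one at a time. -/
theorem Flat.exists_guarded_of_loop {b : Bool} {E : Expr A} (h : Flat b E) :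
    ∃ V, Flat false V ∧ Guarded 0 V ∧ ∀ F,
      Eqv (mu ((Expr.tau (Expr.var 0)).sum (E.sum F))) (mu ((Expr.tau (Expr.var 0)).sum (V.sum F))) := by
  have absorb : ∀ {E V : Expr A}, Eqv ((Expr.tau (Expr.var 0)).sum E) ((Expr.tau (Expr.var 0)).sum V) → ∀ F,
      Eqv (mu ((Expr.tau (Expr.var 0)).sum (E.sum F))) (mu ((Expr.tau (Expr.var 0)).sum (V.sum F))) := fun h F =>
    Eqv.mu ((Eqv.sum_assoc _ _ _).symm.trans ((h.sum (.refl F)).trans (.sum_assoc _ _ _)))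
  have hvar : Eqv ((Expr.tau (Expr.var 0)).sum (Expr.var 0 : Expr A)) ((Expr.tau (Expr.var 0)).sum Expr.nil) :=
    (Eqv.sum_comm _ _).trans ((Eqv.sum_tau _).trans (Eqv.sum_nil _).symm)
  induction h with
  | nil => exact ⟨_, .nil _, trivial, fun _ => .refl _⟩
  | var b k =>
    cases k with
    | zero => exact ⟨_, .nil _, trivial, absorb hvar⟩
    | succ k => exact ⟨_, .var _ (k + 1), Nat.succ_ne_zero k, fun _ => .refl _⟩
  | priVar k =>
    cases k with
    | zero => exact ⟨_, .nil _, trivial, absorb ((Eqv.tau_sum_pri _ _).symm.trans hvar)⟩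
    | succ k => exact ⟨_, .var _ (k + 1), Nat.succ_ne_zero k, absorb (Eqv.tau_sum_pri _ _).symm⟩
  | @tau _ E hE ih =>
    by_cases hg : Guarded 0 E
    · exact ⟨_, .tau _ hE, .inr hg, fun _ => .refl _⟩
    · obtain ⟨V, h1, h2, h3⟩ := ih
      refine ⟨V, h1, h2, fun F => ?_⟩
      have h4 := (Eqv.mu (Eqv.sum_left_comm (Expr.tau (Expr.var 0)) (Expr.tau E) F)).trans
        (hE.eqv_mu_tau hg _)
      refine h4.trans (Eqv.trans (Eqv.mu ?_) (h3 F))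
      exact ((Eqv.refl _).sum (Eqv.sum_left_comm _ _ _)).trans
        ((Eqv.sum_assoc _ _ _).symm.trans ((Eqv.sum_self _).sum (.refl _)))
  | pre _ h h' => exact ⟨_, .pre _ h h', .inl h, fun _ => .refl _⟩
  | @sum _ E E' _ _ ih ih' =>
    obtain ⟨V, h1, h2, h3⟩ := ih
    obtain ⟨V', h1', h2', h3'⟩ := ih'
    refine ⟨_, .sum h1 h1', ⟨h2, h2'⟩, fun F => ?_⟩
    have hc : ∀ E F G : Expr A, Eqv (mu ((Expr.tau (Expr.var 0)).sum ((E.sum F).sum G)))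
        (mu ((Expr.tau (Expr.var 0)).sum (E.sum (F.sum G)))) := fun E F G =>
      Eqv.mu ((Eqv.refl _).sum (.sum_assoc _ _ _))
    have hl : ∀ E F G : Expr A, Eqv (mu ((Expr.tau (Expr.var 0)).sum (E.sum (F.sum G))))
        (mu ((Expr.tau (Expr.var 0)).sum (F.sum (E.sum G)))) := fun E F G =>
      Eqv.mu ((Eqv.refl _).sum (.sum_left_comm _ _ _))
    exact (hc _ _ _).trans ((h3 _).trans ((hl _ _ _).trans ((h3' _).trans
      ((hl _ _ _).trans (hc _ _ _).symm))))

/-- Either X is unguarded at most as a bare summand, which can be split off, or a τ-prefix exposes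
it. The flag `false` excludes a summand pri(X), which neither alternative would cover. -/
theorem Flat.split {E : Expr A} (h : Flat false E) :
    (∃ V, Flat false V ∧ Guarded 0 V ∧ (Eqv E V ∨ Eqv E ((Expr.var 0).sum V))) ∨
      ∃ U, Flat true U ∧ ¬ Guarded 0 U ∧ Eqv E ((Expr.tau U).sum E) := by
  generalize hb : false = b at h
  induction h with
  | nil => exact .inl ⟨_, .nil _, trivial, .inl (.refl _)⟩
  | var b k =>
    cases k with
    | zero => exact .inl ⟨_, .nil _, trivial, .inr (Eqv.sum_nil _).symm⟩
    | succ k => exact .inl ⟨_, .var _ (k + 1), Nat.succ_ne_zero k, .inl (.refl _)⟩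
  | priVar k => cases hb
  | @tau _ E hE ih =>
    by_cases hg : Guarded 0 E
    · exact .inl ⟨_, .tau _ hE, .inr hg, .inl (.refl _)⟩
    · exact .inr ⟨E, hE, hg, (Eqv.sum_self _).symm⟩
  | pre _ h h' => exact .inl ⟨_, .pre _ h h', .inl h, .inl (.refl _)⟩
  | @sum _ E F _ _ ihE ihF =>
    obtain ⟨V, h1, h2, h3⟩ | ⟨U, h1, h2, h3⟩ := ihE hb
    · obtain ⟨W, h4, h5, h6⟩ | ⟨U, h4, h5, h6⟩ := ihF hb
      · refine .inl ⟨_, .sum h1 h4, ⟨h2, h5⟩, ?_⟩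
        obtain h3 | h3 := h3 <;> obtain h6 | h6 := h6
        · exact .inl (h3.sum h6)
        · exact .inr ((h3.sum h6).trans (.sum_left_comm _ _ _))
        · exact .inr ((h3.sum h6).trans (.sum_assoc _ _ _))
        · refine .inr ((h3.sum h6).trans ((Eqv.sum_assoc _ _ _).trans ?_))
          exact ((Eqv.refl _).sum (.sum_left_comm _ _ _)).trans
            ((Eqv.sum_assoc _ _ _).symm.trans ((Eqv.sum_self _).sum (.refl _)))
      · exact .inr ⟨U, h4, h5, h6.of_sum_right⟩
    · exact .inr ⟨U, h1, h2, h3.of_sum_left⟩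

theorem Flat.exists_guarded_mu {E : Expr A} (h : Flat false E) :
    ∃ F, Flat false F ∧ Guarded 0 F ∧ Eqv (mu E) (mu F) := by
  obtain ⟨V, h1, h2, h3 | h3⟩ | ⟨U, h1, h2, h3⟩ := h.split
  · exact ⟨V, h1, h2, Eqv.mu h3⟩
  · exact ⟨V, h1, h2, (Eqv.mu h3).trans (.ung1 V)⟩
  -- Splitting τ.U creates the loop; beside it `U` and `E` become the guarded `V` and `W`. Ung2 then
  -- removes the loop, and the `pri` it leaves is pushed inwards.
  · obtain ⟨V, h4, h5, h6⟩ := h1.exists_guarded_of_loop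
    obtain ⟨W, h7, h8, h9⟩ := h.exists_guarded_of_loop
    obtain ⟨F, h10, h11, h12⟩ := (Flat.sum h4 h7).exists_pri ⟨h5, h8⟩
    refine ⟨_, .tau _ h10, .inr h11, ?_⟩
    have hl : ∀ E F : Expr A, Eqv (mu ((Expr.tau (Expr.var 0)).sum (E.sum F)))
        (mu ((Expr.tau (Expr.var 0)).sum (F.sum E))) := fun E F =>
      Eqv.mu ((Eqv.refl _).sum (.sum_comm _ _))
    exact (Eqv.mu h3).trans ((h1.eqv_mu_tau h2 E).trans ((h6 E).trans ((hl _ _).trans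
      ((h9 V).trans ((hl _ _).trans ((Eqv.ung2 _).trans (Eqv.mu (h12.pre _))))))))

theorem PriFree.exists_flat {E : Expr A} (h : PriFree E) : ∃ F, Flat false F ∧ Eqv E F := by
  induction E with
  | nil => exact ⟨_, .nil _, .refl _⟩
  | var k => exact ⟨_, .var _ k, .refl _⟩
  | pre γ E ih =>
    obtain ⟨F, h1, h2⟩ := ih h
    by_cases hγ : γ = Act.tau
    · subst hγ
      exact ⟨_, .tau _ h1.weaken, h2.pre _⟩
    · exact ⟨_, .pre _ hγ h1.allGuarded, h2.pre _⟩
  | sum E F ihE ihF =>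
    obtain ⟨E', h1, h2⟩ := ihE h.1
    obtain ⟨F', h3, h4⟩ := ihF h.2
    exact ⟨_, .sum h1 h3, h2.sum h4⟩
  | mu E ih =>
    obtain ⟨F, h1, h2⟩ := ih h
    obtain ⟨F', h3, h4, h5⟩ := h1.exists_guarded_mu
    -- One unfolding moves every remaining `mu` below a prefix other than τ, as flatness demands.
    exact ⟨_, h3.inst (F := .mu F') h4 ⟨h4, h3.allGuarded⟩, (Eqv.mu h2).trans (h5.trans (.unfold F'))⟩
  | pri => exact h.elim

/-- Every process is provably equal and congruent to a closed expression with guarded recursion. -/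
theorem exists_allGuarded {P : Expr A} (h : PriFree P) (h' : Closed P) :
    ∃ E, Fixed E ∧ AllGuarded E ∧ Provable P E ∧ Cong P E := by
  obtain ⟨F, h1, h2⟩ := h.exists_flat
  have h3 := h2 fun _ => nil
  rw [closed_iff_fixed.1 h'] at h3
  exact ⟨_, fixed_subst_nil F, h1.allGuarded.subst fun _ => trivial, h3⟩

/-! ### Termination of unfolding and of `τ`-transitions -/

/-- The number of operators that are not below a visible prefix. -/
def unguardedSize : Expr A → ℕ
  | nil => 0
  | var _ => 0
  | pre (Act.prio PAct.tau) E => unguardedSize E + 1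
  | pre (Act.prio (PAct.vis _)) _ => 0
  | pre Act.delta _ => 0
  | sum E F => unguardedSize E + unguardedSize F + 1
  | mu E => unguardedSize E + 1
  | pri E => unguardedSize E + 1

theorem unguardedSize_subst {σ : ℕ → Expr A} {E : Expr A}
    (h : ∀ k, ¬ Guarded k E → ∃ j, σ k = var j) : unguardedSize (subst σ E) = unguardedSize E := by
  induction E generalizing σ with
  | nil => rfl
  | var k =>
    obtain ⟨j, hj⟩ := h k fun h => h rfl
    simp only [subst, hj, unguardedSize]
  | pre γ E ih =>
    match γ with
    | .prio .tau =>
      simp only [subst, unguardedSize]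
      rw [ih fun k hk => h k fun h => hk (h.resolve_left fun h => h rfl)]
    | .prio (.vis a) => rfl
    | .delta => rfl
  | sum E F ihE ihF =>
    simp only [subst, unguardedSize]
    rw [ihE fun k hk => h k fun h => hk h.1, ihF fun k hk => h k fun h => hk h.2]
  | mu E ih =>
    simp only [subst, unguardedSize]
    rw [ih]
    intro k hk
    cases k with
    | zero => exact ⟨0, rfl⟩
    | succ k =>
      obtain ⟨j, hj⟩ := h k hk
      exact ⟨j + 1, by simp only [liftSubst, hj, rename]⟩
  | pri E ih =>
    simp only [subst, unguardedSize]
    rw [ih h]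

/-- The inserted copies sit below prefixes other than τ, where the measure does not look. Unfolding
a guarded recursion thus lowers the measure by one. -/
theorem unguardedSize_inst {E : Expr A} (F : Expr A) (h : Guarded 0 E) :
    unguardedSize (inst E F) = unguardedSize E :=
  unguardedSize_subst fun k hk => by
    cases k with
    | zero => exact (hk h).elim
    | succ k => exact ⟨k, rfl⟩

theorem AllGuarded.unfold {E : Expr A} (h : AllGuarded (mu E)) : AllGuarded (Expr.inst E (mu E)) :=
  AllGuarded.inst h.2 h

/-- A τ-step strips a counted prefix, and unfoldings on the way only lower the measure. This rules
out τ-cycles and later ranks the unknowns of the equation system. -/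
theorem PStep.unguardedSize_lt {P P' : Expr A} {α : PAct A} (h : PStep P α P')
    (hP : AllGuarded P) (hα : α = PAct.tau) : unguardedSize P' < unguardedSize P := by
  induction h with
  | pre α P => subst hα; exact Nat.lt_succ_self _
  | sumL Q _ ih => have := ih hP.1 hα; simp only [unguardedSize]; omega
  | sumR Q _ ih => have := ih hP.2 hα; simp only [unguardedSize]; omega
  | mu _ ih =>
    have := ih hP.unfold hα
    rw [unguardedSize_inst _ hP.1] at this
    simp only [unguardedSize]; omega
  | pri _ ih => have := ih hP hα; simp only [unguardedSize]; omega

/-! ### Derivatives -/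

/-- The immediate derivatives without regard to labels and priorities; the index counts the
unfolded recursions. -/
inductive Der : ℕ → Expr A → Expr A → Prop
  | pre (γ : Act A) (P : Expr A) : Der 0 (pre γ P) P
  | sumL {n : ℕ} {P P' : Expr A} (Q : Expr A) : Der n P P' → Der n (sum P Q) P'
  | sumR {n : ℕ} {Q Q' : Expr A} (P : Expr A) : Der n Q Q' → Der n (sum P Q) Q'
  | mu {n : ℕ} {E P' : Expr A} : Der n (inst E (mu E)) P' → Der (n + 1) (mu E) P'
  | pri {n : ℕ} {P P' : Expr A} : Der n P P' → Der n (pri P) P'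

theorem PStep.der {P P' : Expr A} {α : PAct A} (h : PStep P α P') : ∃ n, Der n P P' := by
  induction h with
  | pre α P => exact ⟨0, .pre _ _⟩
  | sumL Q _ ih => exact ih.imp fun _ => .sumL Q
  | sumR Q _ ih => exact ih.imp fun _ => .sumR Q
  | mu _ ih => exact ih.elim fun n h => ⟨n + 1, .mu h⟩
  | pri _ ih => exact ih.imp fun _ => .pri

theorem DStep.der {P P' : Expr A} (h : DStep P P') : ∃ n, Der n P P' := by
  induction h with
  | pre P => exact ⟨0, .pre _ _⟩
  | sumL _ _ ih => exact ih.imp fun _ => .sumL _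
  | sumR _ _ ih => exact ih.imp fun _ => .sumR _
  | mu _ ih => exact ih.elim fun n h => ⟨n + 1, .mu h⟩

theorem Step.der {P P' : Expr A} {γ : Act A} (h : Step P γ P') : ∃ n, Der n P P' := by
  cases γ with
  | prio α => exact PStep.der h
  | delta => exact DStep.der h

theorem Der.preserves {C : Expr A → Prop} (hpre : ∀ γ P, C (Expr.pre γ P) → C P)
    (hsum : ∀ P Q, C (Expr.sum P Q) → C P ∧ C Q)
    (hmu : ∀ E, C (Expr.mu E) → C (inst E (Expr.mu E))) (hpri : ∀ P, C (Expr.pri P) → C P) {n : ℕ}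
    {P P' : Expr A} (h : Der n P P') (hP : C P) : C P' := by
  induction h with
  | pre γ P => exact hpre γ P hP
  | sumL Q _ ih => exact ih (hsum _ _ hP).1
  | sumR Q _ ih => exact ih (hsum _ _ hP).2
  | mu _ ih => exact ih (hmu _ hP)
  | pri _ ih => exact ih (hpri _ hP)

theorem Der.fixed {n : ℕ} {P P' : Expr A} (h : Der n P P') (hP : Fixed P) : Fixed P' :=
  h.preserves (fun _ _ => Fixed.of_pre) (fun _ _ => Fixed.of_sum) (fun _ => Fixed.unfold)
    (fun _ => Fixed.of_pri) hP

theorem Der.allGuarded {n : ℕ} {P P' : Expr A} (h : Der n P P') (hP : AllGuarded P) :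
    AllGuarded P' :=
  h.preserves (C := AllGuarded) (fun _ _ h => h) (fun _ _ h => h) (fun _ => AllGuarded.unfold)
    (fun _ h => h) hP

theorem Der.priFree {n : ℕ} {P P' : Expr A} (h : Der n P P') (hP : PriFree P) : PriFree P' :=
  h.preserves (C := PriFree) (fun _ _ h => h) (fun _ _ h => h) (fun _ h => PriFree.inst h h)
    (fun _ h => h.elim) hP

/-- The set `T` of expressions is closed under derivatives, uniformly in the values of the free
variables. -/
def DerClosed (T : Set (Expr A)) : Prop :=
  ∀ n, ∀ G ∈ T, ∀ σ P, Der n (subst σ G) P →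
    (∃ H ∈ T, P = subst σ H) ∨ ∃ k, ∃ m ≤ n, Der m (σ k) P

theorem DerClosed.insert_union {T U : Set (Expr A)} (hT : DerClosed T) (hU : DerClosed U)
    {E : Expr A} (hE : ∀ n σ P, Der n (subst σ E) P → ∃ G ∈ T ∪ U, Der n (subst σ G) P ∨
      P = subst σ G) : DerClosed (insert E (T ∪ U)) := by
  have key : ∀ n, ∀ G ∈ T ∪ U, ∀ σ P, Der n (subst σ G) P →
      (∃ H ∈ insert E (T ∪ U), P = subst σ H) ∨ ∃ k, ∃ m ≤ n, Der m (σ k) P := by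
    rintro n G (hG | hG) σ P h
    · exact (hT n G hG σ P h).imp_left fun ⟨H, hH, e⟩ => ⟨H, .inr (.inl hH), e⟩
    · exact (hU n G hG σ P h).imp_left fun ⟨H, hH, e⟩ => ⟨H, .inr (.inr hH), e⟩
  rintro n G (rfl | hG) σ P h
  · obtain ⟨G', hG', h | h⟩ := hE n σ P h
    · exact key n G' hG' σ P h
    · exact .inl ⟨G', .inr hG', h⟩
  · exact key n G hG σ P h

/-- The derivatives of `mu E` are those of `E` with `mu E` filled in. The filled-in copy may be
reached in turn, so the induction is on the number of unfoldings; `hmu` covers the case where the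
index has not dropped. -/
theorem DerClosed.insert_mu {T : Set (Expr A)} (hT : DerClosed T) {E : Expr A} (hE : E ∈ T) :
    DerClosed (insert (mu E) ((fun G => inst G (mu E)) '' T)) := by
  intro n
  induction n using Nat.strong_induction_on with
  | _ n ih =>
    have hmu : ∀ σ P, Der n (mu (subst (liftSubst σ) E)) P →
        (∃ H ∈ insert (mu E) ((fun G => inst G (mu E)) '' T), P = subst σ H) ∨
          ∃ k, ∃ m ≤ n, Der m (σ k) P := by
      intro σ P h
      cases h with
      | @mu n _ _ h =>
        rw [← subst_unfold] at h
        refine (ih n n.lt_succ_self _ (.inr ⟨E, hE, rfl⟩) σ P h).imp_right ?_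
        rintro ⟨k, m, hm, h⟩
        exact ⟨k, m, hm.trans n.le_succ, h⟩
    rintro _ (rfl | ⟨G, hG, rfl⟩) σ P h
    · exact hmu σ P h
    · simp only [subst_inst_eq_subst_consSubst] at h
      obtain ⟨H, hH, rfl⟩ | ⟨k, m, hm, hd⟩ := hT n G hG _ P h
      · exact .inl ⟨_, .inr ⟨H, hH, rfl⟩, (subst_inst_eq_subst_consSubst _ _ _).symm⟩
      · cases k with
        | succ k => exact .inr ⟨k, m, hm, hd⟩
        | zero =>
          obtain rfl | hlt := hm.eq_or_lt
          · exact hmu σ P hd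
          · refine (ih m hlt _ (.inl rfl) σ P hd).imp_right ?_
            rintro ⟨k, m', hm', h⟩
            exact ⟨k, m', hm'.trans hm, h⟩

theorem exists_derClosed (E : Expr A) : ∃ T : Set (Expr A), T.Finite ∧ E ∈ T ∧ DerClosed T := by
  induction E with
  | nil =>
    refine ⟨{nil}, Set.finite_singleton _, rfl, ?_⟩
    rintro n _ rfl σ P h
    cases h
  | var k =>
    refine ⟨{var k}, Set.finite_singleton _, rfl, ?_⟩
    rintro n _ rfl σ P h
    exact .inr ⟨k, n, le_rfl, h⟩
  | pre γ E ih =>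
    obtain ⟨T, h1, h2, h3⟩ := ih
    refine ⟨_, (h1.union h1).insert _, .inl rfl, h3.insert_union h3 fun n σ P h => ?_⟩
    cases h with
    | pre => exact ⟨E, .inl h2, .inr rfl⟩
  | sum E F ihE ihF =>
    obtain ⟨T, h1, h2, h3⟩ := ihE
    obtain ⟨U, h4, h5, h6⟩ := ihF
    refine ⟨_, (h1.union h4).insert _, .inl rfl, h3.insert_union h6 fun n σ P h => ?_⟩
    cases h with
    | sumL _ h => exact ⟨E, .inl h2, .inl h⟩
    | sumR _ h => exact ⟨F, .inr h5, .inl h⟩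
  | mu E ih =>
    obtain ⟨T, h1, h2, h3⟩ := ih
    exact ⟨_, (h1.image _).insert _, .inl rfl, h3.insert_mu h2⟩
  | pri E ih =>
    obtain ⟨T, h1, h2, h3⟩ := ih
    refine ⟨_, (h1.union h1).insert _, .inl rfl, h3.insert_union h3 fun n σ P h => ?_⟩
    cases h with
    | pri h => exact ⟨E, .inl h2, .inl h⟩

/-- A closed expression with guarded recursion has only finitely many derivatives. -/
theorem exists_finite_closed {E : Expr A} (h : Fixed E) (h' : AllGuarded E) :
    ∃ T : Set (Expr A), T.Finite ∧ E ∈ T ∧ (∀ P ∈ T, Fixed P ∧ AllGuarded P) ∧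
      ∀ P ∈ T, ∀ γ P', Step P γ P' → P' ∈ T := by
  obtain ⟨T, h1, h2, h3⟩ := exists_derClosed E
  refine ⟨{P ∈ T | Fixed P ∧ AllGuarded P}, h1.subset fun _ => And.left, ⟨h2, h, h'⟩,
    fun _ => And.right, ?_⟩
  rintro P ⟨hP, hf, hg⟩ γ P' hs
  obtain ⟨n, hd⟩ := Step.der hs
  refine ⟨?_, hd.fixed hf, hd.allGuarded hg⟩
  rw [← subst_var P] at hd
  obtain ⟨H, hH, rfl⟩ | ⟨k, m, -, hd⟩ := h3 n P hP _ _ hd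
  · rwa [subst_var]
  · cases hd

/-! ### Unique solutions of guarded systems of equations -/

theorem freeIn_of_freeIn_rename {k : ℕ} {ρ : ℕ → ℕ} {E : Expr A} (h : FreeIn k (rename ρ E)) :
    ∃ j, ρ j = k ∧ FreeIn j E := by
  induction E generalizing k ρ with
  | nil => exact h.elim
  | var j => exact ⟨j, h, rfl⟩
  | pre γ E ih => exact ih h
  | sum E F ihE ihF =>
    exact h.elim (fun h => (ihE h).imp fun _ => And.imp_right .inl)
      fun h => (ihF h).imp fun _ => And.imp_right .inr
  | mu E ih =>
    obtain ⟨j, hj, hE⟩ := ih h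
    cases j with
    | zero => simp [liftRen] at hj
    | succ j => exact ⟨j, by simpa [liftRen] using hj, hE⟩
  | pri E ih => exact ih h

theorem serial_rename {k : ℕ} {ρ : ℕ → ℕ} {E : Expr A} (h : ∀ j, ρ j = k → Serial j E) :
    Serial k (rename ρ E) := by
  induction E generalizing k ρ with
  | nil => trivial
  | var j => trivial
  | pre γ E ih => exact ih h
  | sum E F ihE ihF => exact ⟨ihE fun j hj => (h j hj).1, ihF fun j hj => (h j hj).2⟩
  | mu E ih =>
    refine ih fun j hj => ?_
    cases j with
    | zero => simp [liftRen] at hj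
    | succ j => exact h j (by simpa [liftRen] using hj)
  | pri E ih =>
    intro hk
    obtain ⟨j, hj, hE⟩ := freeIn_of_freeIn_rename hk
    exact h j hj hE

theorem PriFree.serial_subst {k : ℕ} {σ : ℕ → Expr A} {E : Expr A} (hE : PriFree E)
    (h : ∀ j, Serial k (σ j)) : Serial k (Expr.subst σ E) := by
  induction E generalizing k σ with
  | nil => trivial
  | var j => exact h j
  | pre γ E ih => exact ih hE h
  | sum E F ihE ihF => exact ⟨ihE hE.1 h, ihF hE.2 h⟩
  | mu E ih =>
    refine ih hE fun j => ?_
    cases j with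
    | zero => trivial
    | succ j => exact serial_rename fun i hi => by cases hi; exact h j
  | pri E ih => exact hE.elim

theorem rename_inst (ρ : ℕ → ℕ) (E F : Expr A) :
    rename ρ (inst E F) = inst (rename (liftRen ρ) E) (rename ρ F) := by
  rw [inst, rename_subst, inst, subst_rename]
  congr 1
  funext k
  cases k <;> rfl

theorem liftRen_eq_zero {ρ : ℕ → ℕ} {j : ℕ} (h : liftRen ρ j = 0) : j = 0 := by
  cases j with
  | zero => rfl
  | succ j => simp [liftRen] at h

end Expr

open PriorityCalculus.Expr

theorem Provable.rename {A : Type u} {E F : Expr A} (h : Provable E F) (ρ : ℕ → ℕ) :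
    Provable (Expr.rename ρ E) (Expr.rename ρ F) := by
  induction h generalizing ρ with
  | refl => exact .refl _
  | symm _ ih => exact .symm (ih ρ)
  | trans _ _ ih ih' => exact .trans (ih ρ) (ih' ρ)
  | congrPre γ _ ih => exact .congrPre γ (ih ρ)
  | congrSum _ _ ih ih' => exact .congrSum (ih ρ) (ih' ρ)
  | congrMu _ ih => exact .congrMu (ih _)
  | congrPri _ ih => exact .congrPri (ih ρ)
  | A1 => exact .A1 _ _
  | A2 => exact .A2 _ _ _
  | A3 => exact .A3 _
  | A4 => exact .A4 _
  | Tau1 => exact .Tau1 _ _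
  | Tau2 => exact .Tau2 _
  | Tau3 => exact .Tau3 _ _ _
  | Pri1 => exact .Pri1
  | Pri2 => exact .Pri2 _ _
  | Pri3 => exact .Pri3 _
  | Pri4 => exact .Pri4 _ _
  | Pri5 => exact .Pri5 _
  | Pri6 => exact .Pri6 _ _
  | Rec1 E => rw [rename_inst]; exact .Rec1 _
  | Rec2 E F hs hg _ ih =>
    refine .Rec2 _ _ (serial_rename fun j hj => ?_) (guarded_rename fun j hj => ?_) ?_
    · rwa [liftRen_eq_zero hj]
    · rwa [liftRen_eq_zero hj]
    · rw [← rename_inst]; exact ih ρ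
  | Ung1 => exact .Ung1 _
  | Ung2 => exact .Ung2 _
  | Ung3 => exact .Ung3 _ _
  | Ung4 => exact .Ung4 _ _

namespace Expr

variable {A : Type u}

theorem provable_subst_congr {σ σ' : ℕ → Expr A} (h : ∀ k, Provable (σ k) (σ' k)) (E : Expr A) :
    Provable (subst σ E) (subst σ' E) := by
  induction E generalizing σ σ' with
  | nil => exact .refl _
  | var k => exact h k
  | pre γ E ih => exact .congrPre γ (ih h)
  | sum E F ihE ihF => exact .congrSum (ihE h) (ihF h)
  | mu E ih =>
    refine .congrMu (ih fun k => ?_)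
    cases k with
    | zero => exact .refl _
    | succ k => exact (h k).rename _
  | pri E ih => exact .congrPri (ih h)

/-- Rec2 with the other unknowns as parameters. Lifting keeps index `0` out of the parameters, and
`E` is free of `pri`, so the bound variable is serial even if the parameters contain `pri`. -/
theorem provable_mu_of_provable_subst {E : Expr A} (hE : PriFree E) (hg : Guarded 0 E)
    {P : ℕ → Expr A} (h : Provable (P 0) (subst P E)) :
    Provable (P 0) (subst (fun k => P (k + 1)) (mu E)) := by
  refine .Rec2 _ _ (hE.serial_subst fun j => ?_) (guarded_subst_liftSubst hg) ?_
  · cases j with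
    | zero => trivial
    | succ j => exact serial_rename fun i hi => (Nat.succ_ne_zero i hi).elim
  · rw [inst_subst_liftSubst]
    convert h using 2
    funext k
    cases k <;> rfl

/-- The equation system obtained by eliminating the first variable. -/
theorem provable_subst_inst_mu {E F : Expr A} {P : ℕ → Expr A}
    (h : Provable (P 0) (subst (fun k => P (k + 1)) (mu F))) :
    Provable (subst P E) (subst (fun k => P (k + 1)) (inst E (mu F))) := by
  rw [subst_inst_eq_subst_consSubst]
  refine provable_subst_congr (fun k => ?_) E
  cases k with
  | zero => exact h
  | succ k => exact .refl _

/-- Elimination of unknowns: Rec2 solves the first equation, and its solution is substituted into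
the others. The rank `r` excludes unguarded cycles and survives, since substitution only composes
dependencies. Unknowns from `n` on are parameters on which both families agree. -/
theorem provable_of_solves (n : ℕ) : ∀ (E : ℕ → Expr A) (r : ℕ → ℕ) (P Q : ℕ → Expr A),
    (∀ i, PriFree (E i)) → (∀ i < n, ∀ j < n, ¬ Guarded j (E i) → r j < r i) →
    (∀ i < n, Provable (P i) (subst P (E i))) → (∀ i < n, Provable (Q i) (subst Q (E i))) →
    (∀ k ≥ n, Provable (P k) (Q k)) → ∀ k, Provable (P k) (Q k) := by
  induction n with
  | zero => exact fun E r P Q _ _ _ _ h k => h k k.zero_le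
  | succ n ih =>
    intro E r P Q hE hr hP hQ hPQ
    have hg : Guarded 0 (E 0) := by
      by_contra h
      exact lt_irrefl _ (hr 0 n.succ_pos 0 n.succ_pos h)
    have hP0 := provable_mu_of_provable_subst (hE 0) hg (hP 0 n.succ_pos)
    have hQ0 := provable_mu_of_provable_subst (hE 0) hg (hQ 0 n.succ_pos)
    have key : ∀ k, Provable (P (k + 1)) (Q (k + 1)) := by
      refine ih (fun i => inst (E (i + 1)) (mu (E 0))) (fun i => r (i + 1))
        (fun k => P (k + 1)) (fun k => Q (k + 1)) (fun i => (hE _).inst (hE 0)) ?_ ?_ ?_ ?_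
      · intro i hi j hj hij
        by_contra hlt
        refine hij (guarded_subst fun l hl => ?_)
        cases l with
        | zero =>
          have h1 := hr (i + 1) (by omega) 0 n.succ_pos hl
          by_contra h2
          have h3 := hr 0 n.succ_pos (j + 1) (by omega) h2
          omega
        | succ l =>
          rintro rfl
          exact hlt (hr (i + 1) (by omega) (l + 1) (by omega) hl)
      · exact fun i hi => .trans (hP (i + 1) (by omega)) (provable_subst_inst_mu hP0)
      · exact fun i hi => .trans (hQ (i + 1) (by omega)) (provable_subst_inst_mu hQ0)
      · exact fun k hk => hPQ (k + 1) (by omega)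
    intro k
    cases k with
    | zero => exact .trans hP0 (.trans (provable_subst_congr key _) (.symm hQ0))
    | succ k => exact key k

/-- The choice between the given prefixes. -/
def choice : List (Act A × Expr A) → Expr A
  | [] => nil
  | x :: l => sum (pre x.1 x.2) (choice l)

theorem subst_choice (σ : ℕ → Expr A) (l : List (Act A × Expr A)) :
    subst σ (choice l) = choice (l.map fun x => (x.1, subst σ x.2)) := by
  induction l with
  | nil => rfl
  | cons x l ih => simp only [choice, subst, List.map_cons, ih]

theorem priFree_choice {l : List (Act A × Expr A)} (h : ∀ x ∈ l, PriFree x.2) :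
    PriFree (choice l) := by
  induction l with
  | nil => trivial
  | cons x l ih =>
    exact ⟨h x List.mem_cons_self, ih fun y hy => h y (List.mem_cons_of_mem _ hy)⟩

theorem guarded_choice {k : ℕ} {l : List (Act A × Expr A)}
    (h : ∀ x ∈ l, x.1 = Act.tau → Guarded k x.2) : Guarded k (choice l) := by
  induction l with
  | nil => trivial
  | cons x l ih =>
    refine ⟨?_, ih fun y hy => h y (List.mem_cons_of_mem _ hy)⟩
    by_cases hx : x.1 = Act.tau
    · exact .inr (h x List.mem_cons_self hx)
    · exact .inl hx

/-- Two solutions of a finite system of equations without `τ`-cycles are provably equal. -/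
theorem provable_of_solves_finite {ι : Type*} [Finite ι] (T : ι → List (Act A × ι)) (r : ι → ℕ)
    (hr : ∀ i, ∀ x ∈ T i, x.1 = Act.tau → r x.2 < r i) (P Q : ι → Expr A)
    (hP : ∀ i, Provable (P i) (choice ((T i).map fun x => (x.1, P x.2))))
    (hQ : ∀ i, Provable (Q i) (choice ((T i).map fun x => (x.1, Q x.2)))) (i : ι) :
    Provable (P i) (Q i) := by
  obtain ⟨n, ⟨e⟩⟩ := Finite.exists_equiv_fin ι
  let ext : (ι → Expr A) → ℕ → Expr A := fun P k =>
    if h : k < n then P (e.symm ⟨k, h⟩) else nil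
  have hext : ∀ P i, ext P (e i) = P i := fun P i => by simp [ext]
  let E : ℕ → Expr A := ext fun i => choice ((T i).map fun x => (x.1, var (e x.2)))
  have hE : ∀ i, E (e i) = choice ((T i).map fun x => (x.1, var (e x.2))) := fun i => by
    simp only [E, hext]
  let r' : ℕ → ℕ := fun k => if h : k < n then r (e.symm ⟨k, h⟩) else 0
  have hr' : ∀ i, r' (e i) = r i := fun i => by simp [r']
  have hlt : ∀ k < n, ∃ i, k = e i := fun k hk => ⟨e.symm ⟨k, hk⟩, by simp⟩
  have hsol : ∀ P : ι → Expr A,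
      (∀ i, Provable (P i) (choice ((T i).map fun x => (x.1, P x.2)))) →
      ∀ k < n, Provable (ext P k) (subst (ext P) (E k)) := by
    intro P hP k hk
    obtain ⟨i, rfl⟩ := hlt k hk
    rw [hext, hE, subst_choice, List.map_map]
    convert hP i using 3
    funext x
    simp only [Function.comp, subst, hext]
  have := provable_of_solves n E r' (ext P) (ext Q) ?_ ?_ (hsol P hP) (hsol Q hQ) ?_ (e i)
  · rwa [hext, hext] at this
  · intro k
    by_cases hk : k < n
    · obtain ⟨i, rfl⟩ := hlt k hk
      rw [hE]
      refine priFree_choice fun x hx => ?_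
      obtain ⟨y, -, rfl⟩ := List.mem_map.1 hx
      trivial
    · simp only [E, ext, dif_neg hk]
      trivial
  · intro k hk l hl h
    obtain ⟨i, rfl⟩ := hlt k hk
    obtain ⟨j, rfl⟩ := hlt l hl
    rw [hr', hr']
    by_contra hij
    rw [hE] at h
    refine h (guarded_choice fun x hx hτ => ?_)
    obtain ⟨y, hy, rfl⟩ := List.mem_map.1 hx
    intro hyj
    have : y.2 = j := e.injective (Fin.ext hyj)
    exact hij (this ▸ hr i y hy hτ)
  · intro k hk
    simp only [ext, dif_neg (not_lt.2 hk)]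
    exact .refl _

/-! ### Provable summands -/

/-- Provably, the first expression is a summand of the second. -/
def Summand (E F : Expr A) : Prop := Provable (sum E F) F

namespace Summand

variable {E F G : Expr A}

theorem of_provable (h : Provable E F) : Summand E F :=
  Provable.trans (.congrSum h (.refl _)) (.A3 _)

theorem refl (E : Expr A) : Summand E E := .A3 E

theorem trans (h : Summand E F) (h' : Summand F G) : Summand E G :=
  Provable.trans (.congrSum (.refl _) (.symm h'))
    (Provable.trans (.symm (.A2 _ _ _)) (Provable.trans (.congrSum h (.refl _)) h'))

theorem antisymm (h : Summand E F) (h' : Summand F E) : Provable E F :=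
  Provable.trans (.symm h') (Provable.trans (.A1 _ _) h)

theorem sum (h : Summand E G) (h' : Summand F G) : Summand (sum E F) G :=
  Provable.trans (.A2 _ _ _) (Provable.trans (.congrSum (.refl _) h') h)

theorem left (E F : Expr A) : Summand E (E.sum F) :=
  Provable.trans (.symm (.A2 _ _ _)) (.congrSum (.A3 _) (.refl _))

theorem right (E F : Expr A) : Summand E (F.sum E) :=
  (left E F).trans (of_provable (.A1 _ _))

theorem nil (E : Expr A) : Summand nil E := Provable.trans (.A1 _ _) (.A4 _)

theorem tau (E : Expr A) : Summand E (tau E) := .Tau2 E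

theorem pre_congr (γ : Act A) (h : Provable E F) : Summand (pre γ E) (pre γ F) :=
  of_provable (.congrPre γ h)

end Summand

theorem choice_summand {l : List (Act A × Expr A)} {G : Expr A}
    (h : ∀ x ∈ l, Summand (pre x.1 x.2) G) : Summand (choice l) G := by
  induction l with
  | nil => exact .nil G
  | cons x l ih =>
    exact (h x List.mem_cons_self).sum (ih fun y hy => h y (List.mem_cons_of_mem _ hy))

theorem summand_choice {l : List (Act A × Expr A)} {x : Act A × Expr A} (h : x ∈ l) :
    Summand (pre x.1 x.2) (choice l) := by
  induction l with
  | nil => cases h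
  | cons y l ih =>
    obtain rfl | h := List.mem_cons.1 h
    · exact .left _ _
    · exact (ih h).trans (.right _ _)

/-- Pre-emption in axiomatic form: beside a τ-prefix, Pri6 puts the δ-prefix under `pri` and Pri3
erases it. -/
theorem delta_summand_tau (E F : Expr A) : Summand (pre Act.delta E) (tau F) :=
  Provable.trans (.A1 _ _)
    (.trans (.Pri6 _ _) (.trans (.congrSum (.refl _) (.Pri3 _)) (.A4 _)))

/-! ### Head normal forms -/

/-- Whether the action is prioritized. -/
def _root_.PriorityCalculus.Act.isPrio : Act A → Bool
  | Act.prio _ => true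
  | Act.delta => false

theorem provable_pri_choice (l : List (Act A × Expr A)) :
    Provable (pri (choice l)) (choice (l.filter fun x => x.1.isPrio)) := by
  induction l with
  | nil => exact .Pri1
  | cons x l ih =>
    obtain ⟨γ, E⟩ := x
    refine .trans (.Pri4 _ _) ?_
    cases γ with
    | prio α => exact .congrSum (.Pri2 _ _) ih
    | delta =>
      exact .trans (.congrSum (.Pri3 _) ih) (.trans (.A1 _ _) (.A4 _))

/-- The measure falls at each unfolding because recursion is guarded. In an unstable choice the
δ-prefixes are not transitions; they are dropped because a τ-prefix absorbs them. -/
theorem exists_choice {E : Expr A} (hf : Fixed E) (hg : AllGuarded E) :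
    ∃ l : List (Act A × Expr A), (∀ x, x ∈ l ↔ Step E x.1 x.2) ∧ Provable E (choice l) := by
  induction hn : unguardedSize E using Nat.strong_induction_on generalizing E with
  | _ n ih =>
    subst hn
    match E with
    | nil =>
      refine ⟨[], fun ⟨γ, P⟩ => ?_, .refl _⟩
      cases γ <;> simp [Step, not_pStep_nil, not_dStep_nil]
    | var k => exact absurd (hf fun _ => nil) (by simp [subst])
    | pre γ E =>
      refine ⟨[(γ, E)], fun ⟨γ', P⟩ => ?_, .symm (.A4 _)⟩
      cases γ' <;> simp [Step, pStep_pre_iff, dStep_pre_iff, eq_comm]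
    | sum E F =>
      obtain ⟨l, h1, h2⟩ := ih _ (by simp only [unguardedSize]; omega) hf.of_sum.1 hg.1 rfl
      obtain ⟨l', h3, h4⟩ := ih _ (by simp only [unguardedSize]; omega) hf.of_sum.2 hg.2 rfl
      have happ : Provable (sum E F) (choice (l ++ l')) := by
        refine .trans (.congrSum h2 h4) (Summand.antisymm ?_ ?_)
        · exact (choice_summand fun x hx => summand_choice (List.mem_append_left _ hx)).sum
            (choice_summand fun x hx => summand_choice (List.mem_append_right _ hx))
        · refine choice_summand fun x hx => ?_
          obtain hx | hx := List.mem_append.1 hx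
          · exact (summand_choice hx).trans (.left _ _)
          · exact (summand_choice hx).trans (.right _ _)
      by_cases hs : Stable (sum E F)
      · refine ⟨l ++ l', fun x => ?_, happ⟩
        rw [List.mem_append, h1, h3]
        obtain ⟨γ, P⟩ := x
        cases γ with
        | prio α => exact pStep_sum_iff.symm
        | delta =>
          exact ⟨fun h => dStep_sum_iff.2 ⟨h, stable_sum_iff.1 hs⟩, fun h => (dStep_sum_iff.1 h).1⟩
      · refine ⟨(l ++ l').filter fun x => x.1.isPrio, fun x => ?_, .trans happ ?_⟩
        · rw [List.mem_filter, List.mem_append, h1, h3]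
          obtain ⟨γ, P⟩ := x
          cases γ with
          | prio α => simpa [Step, Act.isPrio] using pStep_sum_iff.symm
          | delta => simpa [Step, Act.isPrio] using fun h : DStep _ _ => hs h.stable
        · obtain ⟨Q, hQ⟩ := not_not.1 hs
          have hQ' : (Act.tau, Q) ∈ (l ++ l').filter fun x => x.1.isPrio := by
            rw [List.mem_filter, List.mem_append, h1, h3]
            exact ⟨pStep_sum_iff.1 hQ, rfl⟩
          refine Summand.antisymm (choice_summand fun x hx => ?_) (choice_summand fun x hx =>
            summand_choice (List.mem_filter.1 hx).1)
          obtain ⟨γ, P⟩ := x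
          cases γ with
          | prio α => exact summand_choice (x := (.prio α, P)) (List.mem_filter.2 ⟨hx, rfl⟩)
          | delta => exact (delta_summand_tau P Q).trans (summand_choice hQ')
    | mu E =>
      obtain ⟨l, h1, h2⟩ := ih (unguardedSize (inst E (mu E)))
        (by rw [unguardedSize_inst _ hg.1]; simp only [unguardedSize]; omega)
        hf.unfold hg.unfold rfl
      refine ⟨l, fun x => ?_, .trans (.Rec1 _) h2⟩
      rw [h1]
      obtain ⟨γ, P⟩ := x
      cases γ with
      | prio α => exact pStep_mu_iff.symm
      | delta => exact dStep_mu_iff.symm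
    | pri E =>
      obtain ⟨l, h1, h2⟩ := ih (unguardedSize E) (by simp only [unguardedSize]; omega)
        hf.of_pri hg rfl
      refine ⟨_, fun x => ?_, .trans (.congrPri h2) (provable_pri_choice l)⟩
      rw [List.mem_filter, h1]
      obtain ⟨γ, P⟩ := x
      cases γ with
      | prio α => simpa [Step, Act.isPrio] using pStep_pri_iff.symm
      | delta => simpa [Step, Act.isPrio] using not_dStep_pri

/-! ### Saturation -/

/-- Closed expressions with guarded recursion. -/
def Regular (P : Expr A) : Prop := Fixed P ∧ AllGuarded P

namespace Regular

variable {P P' : Expr A} {γ : Act A}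

theorem step (hP : Regular P) (h : Step P γ P') : Regular P' :=
  (Step.der h).elim fun _ h => ⟨h.fixed hP.1, h.allGuarded hP.2⟩

theorem tauStar (hP : Regular P) (h : TauStar Step P P') : Regular P' := by
  induction h with
  | refl => exact hP
  | tail _ h ih => exact ih.step h

theorem unguardedSize_lt_of_tauStar (hP : Regular P) (h : TauStar Step P P') :
    P' = P ∨ unguardedSize P' < unguardedSize P := by
  induction h with
  | refl => exact .inl rfl
  | tail h' h ih =>
    have := PStep.unguardedSize_lt h (hP.tauStar h').2 rfl
    obtain rfl | ih := ih
    · exact .inr this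
    · exact .inr (this.trans ih)

theorem summand_of_step (hP : Regular P) (h : Step P γ P') : Summand (pre γ P') P := by
  obtain ⟨l, h1, h2⟩ := exists_choice hP.1 hP.2
  exact (summand_choice ((h1 (γ, P')).2 h)).trans (.of_provable (.symm h2))

theorem summand_of_tauStar (hP : Regular P) (h : TauStar Step P P') : Summand P' P := by
  induction h with
  | refl => exact .refl P
  | tail h' h ih => exact ((Summand.tau _).trans ((hP.tauStar h').summand_of_step h)).trans ih

/-- Each step of the path is an instance of Tau3, after writing its source `Q` as `Q + τ.Q'`. -/
theorem pre_summand_of_tauStar (hP : Regular P) (h : TauStar Step P P') (γ : Act A) :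
    Summand (pre γ P') (pre γ P) := by
  induction h with
  | refl => exact .refl _
  | @tail Q Q' h' h ih =>
    refine Summand.trans ?_ ih
    have h1 : Provable (sum Q (Expr.tau Q')) Q :=
      .trans (.A1 _ _) ((hP.tauStar h').summand_of_step h)
    exact ((Summand.right _ _).trans (.of_provable (.Tau3 γ Q Q'))).trans (.pre_congr γ h1)

theorem summand_of_weak (hP : Regular P) (h : Weak Step P γ P') : Summand (pre γ P') P := by
  obtain ⟨Q, Q', h1, h2, h3⟩ := h
  have hQ := hP.tauStar h1
  exact (((hQ.step h2).pre_summand_of_tauStar h3 γ).trans (hQ.summand_of_step h2)).trans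
    (hP.summand_of_tauStar h1)

end Regular

/-- If the prefixes collected in `l` are weak transitions of `P`, possibly with `τ.P`, and all
transitions of `P` are among them, then the choice between them is `P` up to a leading `τ`. -/
theorem provable_pre_choice {P : Expr A} (hP : Regular P) {l : List (Act A × Expr A)}
    (h : ∀ x ∈ l, WeakHat Step P x.1 x.2) (h' : ∀ γ P', Step P γ P' → (γ, P') ∈ l) (γ : Act A) :
    Provable (pre γ (choice l)) (pre γ P) := by
  have h1 : Summand P (choice l) := by
    obtain ⟨l', h1, h2⟩ := exists_choice hP.1 hP.2
    refine (Summand.of_provable h2).trans (choice_summand fun x hx => summand_choice ?_)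
    exact h' _ _ ((h1 x).1 hx)
  have h2 : ∀ x ∈ l, x = (Act.tau, P) ∨ Summand (pre x.1 x.2) P := by
    intro x hx
    obtain ⟨hτ, hs⟩ | ⟨-, hw⟩ := h x hx
    · obtain hs | ⟨Q, hQ, hs⟩ := Relation.ReflTransGen.cases_head hs
      · exact .inl (Prod.ext hτ hs.symm)
      · refine .inr (hP.summand_of_weak ⟨P, Q, .refl, ?_, hs⟩)
        rwa [hτ]
    · exact .inr (hP.summand_of_weak hw)
  -- If τ.P is listed, the choice collapses to it by Tau2, and Tau1 erases the additional τ below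
  -- `γ`. Otherwise the choice equals `P`.
  by_cases hτ : (Act.tau, P) ∈ l
  · have h3 : Provable (choice l) (tau P) := by
      refine Summand.antisymm (choice_summand fun x hx => ?_) (summand_choice hτ)
      obtain rfl | h := h2 x hx
      · exact .refl _
      · exact h.trans (.tau P)
    exact .trans (.congrPre γ h3) (.Tau1 γ P)
  · refine .congrPre γ (Summand.antisymm (choice_summand fun x hx => ?_) h1)
    exact (h2 x hx).resolve_left fun h => hτ (h ▸ hx)

/-! ### Completeness -/

/-- There may be infinitely many actions, but a head normal form shows that each expression uses
finitely many. -/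
theorem exists_finite_actions {T : Set (Expr A)} (hT : T.Finite)
    (hreg : ∀ P ∈ T, Regular P) :
    {γ : Act A | ∃ P ∈ T, ∃ P', Step P γ P'}.Finite := by
  have : {γ : Act A | ∃ P ∈ T, ∃ P', Step P γ P'} = ⋃ P ∈ T, {γ | ∃ P', Step P γ P'} := by
    ext; simp
  rw [this]
  refine hT.biUnion fun P hP => ?_
  obtain ⟨l, h1, -⟩ := exists_choice (hreg P hP).1 (hreg P hP).2
  refine (l.map Prod.fst).finite_toSet.subset ?_
  rintro γ ⟨P', h⟩
  exact List.mem_map.2 ⟨(γ, P'), (h1 _).2 h, rfl⟩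

/-- A τ of `P` matched by idling forces a summand τ.Q on the other side. The common system is
therefore solved by the saturated choices, which agree with `P` and `Q` only below a prefix. -/
theorem provable_pre_of_bisim {T : Set (Expr A)} (hT : T.Finite) (hreg : ∀ P ∈ T, Regular P)
    (hstep : ∀ P ∈ T, ∀ γ P', Step P γ P' → P' ∈ T) {P Q : Expr A} (hP : P ∈ T) (hQ : Q ∈ T)
    (h : Bisim P Q) (γ : Act A) : Provable (pre γ P) (pre γ Q) := by
  have hstar : ∀ {P P'}, P ∈ T → TauStar Step P P' → P' ∈ T := by
    intro P P' hP h
    induction h with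
    | refl => exact hP
    | tail _ h ih => exact hstep _ ih _ _ h
  have hhat : ∀ {P γ P'}, P ∈ T → WeakHat Step P γ P' → P' ∈ T := by
    rintro P γ P' hP (⟨-, h⟩ | ⟨-, Q, Q', h1, h2, h3⟩)
    · exact hstar hP h
    · exact hstar (hstep _ (hstar hP h1) _ _ h2) h3
  let ι := {x : Expr A × Expr A // x ∈ T ×ˢ T ∧ Bisim x.1 x.2}
  have : Finite ι := ((hT.prod hT).subset fun x hx => hx.1 :
    {x : Expr A × Expr A | x ∈ T ×ˢ T ∧ Bisim x.1 x.2}.Finite)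
  -- The idle τ from a pair to itself is left out; it would make the system unguarded.
  let R : ι → Set (Act A × ι) := fun i => {x | WeakHat Step i.1.1 x.1 x.2.1.1 ∧
    WeakHat Step i.1.2 x.1 x.2.1.2 ∧ ¬ (x.1 = Act.tau ∧ x.2.1 = i.1)}
  have hR : ∀ i, (R i).Finite := by
    intro i
    refine (((exists_finite_actions hT hreg).insert Act.tau).prod Set.finite_univ).subset ?_
    rintro ⟨γ, j⟩ ⟨⟨hτ, -⟩ | ⟨-, Q, Q', h1, h2, -⟩, -⟩
    · exact ⟨.inl hτ, trivial⟩
    · exact ⟨.inr ⟨Q, hstar i.2.1.1 h1, Q', h2⟩, trivial⟩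
  let L : ι → List (Act A × ι) := fun i => (hR i).toFinset.toList
  have hL : ∀ i x, x ∈ L i ↔ x ∈ R i := fun i x => by simp [L]
  -- A genuine τ-step changes the state, so the exclusion of the idle move loses no transition.
  have hne : ∀ {P P' : Expr A}, Regular P → PStep P PAct.tau P' → P' ≠ P := by
    rintro P _ hP h rfl
    exact lt_irrefl _ (h.unguardedSize_lt hP.2 rfl)
  have hfst : ∀ (i : ι) (γ : Act A),
      Provable (pre γ (choice ((L i).map fun x => (x.1, x.2.1.1)))) (pre γ i.1.1) := by
    intro i
    refine provable_pre_choice (hreg _ i.2.1.1) ?_ fun γ P' h => ?_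
    · intro x hx
      obtain ⟨y, hy, rfl⟩ := List.mem_map.1 hx
      exact ((hL i y).1 hy).1
    · obtain ⟨Q', hQ', hb⟩ := isSimulation_weakBisimilar _ _ i.2.2 _ _ h
      refine List.mem_map.2 ⟨(γ, ⟨(P', Q'), ⟨hstep _ i.2.1.1 _ _ h, hhat i.2.1.2 hQ'⟩, hb⟩),
        (hL i _).2 ⟨(Weak.single h).weakHat, hQ', ?_⟩, rfl⟩
      rintro ⟨rfl, he⟩
      exact hne (hreg _ i.2.1.1) h (congrArg Prod.fst he)
  have hsnd : ∀ (i : ι) (γ : Act A),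
      Provable (pre γ (choice ((L i).map fun x => (x.1, x.2.1.2)))) (pre γ i.1.2) := by
    intro i
    refine provable_pre_choice (hreg _ i.2.1.2) ?_ fun γ Q' h => ?_
    · intro x hx
      obtain ⟨y, hy, rfl⟩ := List.mem_map.1 hx
      exact ((hL i y).1 hy).2.1
    · obtain ⟨P', hP', hb⟩ := isSimulation_weakBisimilar _ _ i.2.2.symm _ _ h
      refine List.mem_map.2 ⟨(γ, ⟨(P', Q'), ⟨hhat i.2.1.1 hP', hstep _ i.2.1.2 _ _ h⟩, hb.symm⟩),
        (hL i _).2 ⟨hP', (Weak.single h).weakHat, ?_⟩, rfl⟩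
      rintro ⟨rfl, he⟩
      exact hne (hreg _ i.2.1.2) h (congrArg Prod.snd he)
  have hcongr : ∀ {l : List (Act A × ι)} {f g : ι → Expr A},
      (∀ i γ, Provable (pre γ (f i)) (pre γ (g i))) →
      Provable (choice (l.map fun x => (x.1, f x.2))) (choice (l.map fun x => (x.1, g x.2))) := by
    intro l f g hfg
    induction l with
    | nil => exact .refl _
    | cons x l ih => exact .congrSum (hfg x.2 x.1) ih
  let i : ι := ⟨(P, Q), ⟨hP, hQ⟩, h⟩
  refine .trans (.symm (hfst i γ)) (.trans (.congrPre γ ?_) (hsnd i γ))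
  refine provable_of_solves_finite L (fun i => unguardedSize i.1.1 + unguardedSize i.1.2) ?_
    (fun i => choice ((L i).map fun x => (x.1, x.2.1.1)))
    (fun i => choice ((L i).map fun x => (x.1, x.2.1.2)))
    (fun i => hcongr fun i γ => .symm (hfst i γ)) (fun i => hcongr fun i γ => .symm (hsnd i γ)) i
  -- Along a τ-summand each component stays or its measure falls; they do not both stay, so the sum
  -- of the measures decreases.
  rintro i ⟨γ, j⟩ hx rfl
  obtain ⟨h1, h2, h3⟩ := (hL i _).1 hx
  have h4 := (hreg _ i.2.1.1).unguardedSize_lt_of_tauStar h1.tauStar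
  have h5 := (hreg _ i.2.1.2).unguardedSize_lt_of_tauStar h2.tauStar
  dsimp only at h3 h4 h5 ⊢
  obtain h4 | h4 := h4 <;> obtain h5 | h5 := h5
  · exact (h3 ⟨rfl, Prod.ext h4 h5⟩).elim
  · rw [h4]; omega
  · rw [h5]; omega
  · omega

theorem Regular.provable_of_cong {P Q : Expr A} (hP : Regular P) (hQ : Regular Q)
    (h : Cong P Q) : Provable P Q := by
  obtain ⟨T, h1, h2, h3, h4⟩ := exists_finite_closed hP.1 hP.2
  obtain ⟨U, h5, h6, h7, h8⟩ := exists_finite_closed hQ.1 hQ.2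
  have hreg : ∀ P ∈ T ∪ U, Regular P := fun P hP => hP.elim (h3 P) (h7 P)
  have hstep : ∀ P ∈ T ∪ U, ∀ γ P', Step P γ P' → P' ∈ T ∪ U := fun P hP γ P' h =>
    hP.imp (fun hP => h4 P hP γ P' h) fun hP => h8 P hP γ P' h
  have hstar : ∀ {P P'}, P ∈ T ∪ U → TauStar Step P P' → P' ∈ T ∪ U := by
    intro P P' hP h
    induction h with
    | refl => exact hP
    | tail _ h ih => exact hstep _ ih _ _ h
  have hweak : ∀ {P γ P'}, P ∈ T ∪ U → Weak Step P γ P' → P' ∈ T ∪ U := by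
    rintro P γ P' hP ⟨Q, Q', h1, h2, h3⟩
    exact hstar (hstep _ (hstar hP h1) _ _ h2) h3
  -- A summand γ.P' of `P` equals γ.Q' for a bisimilar weak derivative Q' of `Q`, and saturation
  -- makes γ.Q' a summand of `Q`.
  have key : ∀ {P Q}, P ∈ T ∪ U → Q ∈ T ∪ U → Cong P Q → Summand P Q := by
    intro P Q hP hQ h
    obtain ⟨l, hl, hl'⟩ := exists_choice (hreg P hP).1 (hreg P hP).2
    refine (Summand.of_provable hl').trans (choice_summand fun x hx => ?_)
    have hs := (hl x).1 hx
    obtain ⟨Q', hw, hb⟩ := h.1 _ _ hs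
    exact (Summand.of_provable (provable_pre_of_bisim (h1.union h5) hreg hstep
      (hstep P hP _ _ hs) (hweak hQ hw) hb x.1)).trans ((hreg Q hQ).summand_of_weak hw)
  exact (key (.inl h2) (.inr h6) h).antisymm (key (.inr h6) (.inl h2) h.symm)

end Expr

/-! ### From processes to arbitrary expressions -/

namespace Proc

variable {A : Type u} {P Q : Proc A} {γ : Act A}

theorem exists_step {E : Expr A} (h : Expr.Step P.1 γ E) : ∃ P' : Proc A, P'.1 = E ∧ P.Step γ P' :=
  (Step.der h).elim fun _ hd =>
    ⟨⟨E, hd.priFree P.2.1, closed_iff_fixed.2 (hd.fixed (closed_iff_fixed.1 P.2.2))⟩, rfl, h⟩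

theorem tauStar_val (h : TauStar Proc.Step P Q) : TauStar Expr.Step P.1 Q.1 := by
  induction h with
  | refl => exact .refl
  | tail _ h ih => exact ih.tail h

theorem weak_val (h : Weak Proc.Step P γ Q) : Weak Expr.Step P.1 γ Q.1 := by
  obtain ⟨P', Q', h1, h2, h3⟩ := h
  exact ⟨P'.1, Q'.1, tauStar_val h1, h2, tauStar_val h3⟩

/-- Transitions preserve closedness and freedom from `pri`, so a bisimulation of processes remains
one among all expressions. The larger state space is needed because normal forms may contain `pri`.
-/
theorem bisim_val (h : WeakBisimilar Proc.Step P Q) : Bisim P.1 Q.1 := by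
  have key : IsSimulation Expr.Step fun E F : Expr A =>
      ∃ P Q : Proc A, P.1 = E ∧ Q.1 = F ∧ WeakBisimilar Proc.Step P Q := by
    rintro _ _ ⟨P, Q, rfl, rfl, h⟩ γ E hE
    obtain ⟨P', rfl, hP'⟩ := exists_step hE
    obtain ⟨Q', hQ', hb⟩ := isSimulation_weakBisimilar _ _ h _ _ hP'
    exact ⟨Q'.1, hQ'.imp (And.imp_right tauStar_val) (And.imp_right weak_val), P', Q', rfl, rfl, hb⟩
  refine ⟨_, isWeakBisimulation_iff.2 ⟨key, ?_⟩, P, Q, rfl, rfl, h⟩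
  rintro _ _ ⟨P, Q, rfl, rfl, h⟩ γ E hE
  obtain ⟨F, hF, Q', P', rfl, rfl, hb⟩ := key _ _ ⟨Q, P, rfl, rfl, h.symm⟩ γ E hE
  exact ⟨_, hF, P', Q', rfl, rfl, hb.symm⟩

theorem cong_val (h : ObsCongruent Proc.Step P Q) : Cong P.1 Q.1 := by
  have key : ∀ {P Q : Proc A}, ObsCongruent Proc.Step P Q → ∀ γ E, Expr.Step P.1 γ E →
      ∃ F, Weak Expr.Step Q.1 γ F ∧ Bisim E F := by
    intro P Q h γ E hE
    obtain ⟨P', rfl, hP'⟩ := exists_step hE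
    obtain ⟨Q', hQ', hb⟩ := h.1 _ _ hP'
    exact ⟨Q'.1, weak_val hQ', bisim_val hb⟩
  refine ⟨key h, fun γ F hF => ?_⟩
  obtain ⟨E, h1, h2⟩ := key h.symm γ F hF
  exact ⟨E, h1, h2.symm⟩

end Proc

end PriorityCalculus

theorem mainTheorem1 {A : Type*} (P Q : PriorityCalculus.Proc A)
    (h : PriorityCalculus.ObsCongruent (PriorityCalculus.Proc.Step (A := A)) P Q) :
    PriorityCalculus.Provable P.1 Q.1 := by
  obtain ⟨E, h1, h2, h3, h4⟩ := PriorityCalculus.Expr.exists_allGuarded P.2.1 P.2.2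
  obtain ⟨F, h5, h6, h7, h8⟩ := PriorityCalculus.Expr.exists_allGuarded Q.2.1 Q.2.2
  refine .trans h3 (.trans ?_ (.symm h7))
  exact PriorityCalculus.Expr.Regular.provable_of_cong ⟨h1, h2⟩ ⟨h5, h6⟩
    ((h4.symm.trans (PriorityCalculus.Proc.cong_val h)).trans h8)
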